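/- Let $K$ be a totally real cubic number field whose discriminant $d$ is a fundamental discriminant, i.e. $d$ is the discriminant of some quadratic field. Put $d_3 = -3d/\gcd(3,d)^2$. Let $O_K^0$ be the set of algebraic integers $x\in K$ with $\mathrm{tr}_{K/\mathbb{Q}}(x)=0$, and for $x\in O_K^0$ put $$t_K(x)=\frac{\mathrm{tr}_{K/\mathbb{Q}}(x^2)}{2\gcd(3,d)}.$$ Then the series $$f_K(z)=\sum_{x\in O_K^0} e^{2\pi i z\, t_K(x)}$$ converges absolutely for every $z$ in the upper half plane, the Kronecker symbol $n\mapsto\left(\frac{d_3}{n}\right)$ is a Dirichlet character modulo $|d_3|$, and $$f_K\in \mathcal{M}_1\left(\Gamma_0(|d_3|),\left(\frac{d_3}{\cdot}\right)\right).$$ Here, for a Dirichlet character $\chi$ modulo $N$, $\mathcal{M}_1(\Gamma_0(N),\chi)$ is the space of holomorphic functions $f$ on the upper half plane that are bounded at every cusp (as weight one forms) and satisfy $f\left(\frac{az+b}{cz+e}\right)=\chi(e)(cz+e)f(z)$ for all $\begin{pmatrix}a&b\\c&e\end{pmatrix}\in\Gamma_0(N)$. -/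

import Mathlib

open scoped MatrixGroups ModularForm NumberField

noncomputable section

/-- An integer is a fundamental discriminant when it is the discriminant of a quadratic field. -/
def IsFundamentalDiscriminant (d : ℤ) : Prop :=
  ∃ (F : Type) (_ : Field F) (_ : NumberField F),
    Module.finrank ℚ F = 2 ∧ NumberField.discr F = d

/-- The `3`-reflection `d₃ = -3d / gcd(3,d)²` of an integer `d` (the division is exact). -/
def threeReflection (d : ℤ) : ℤ :=
  (-(3 * d)) / ((Int.gcd 3 d : ℤ) ^ 2)

/-- The Kronecker symbol `(a / n)` for arbitrary integers `a` and `n`: writing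
`n = u * 2 ^ v * m` with `u = ± 1` and `m` odd and positive, it is `(a / u) (a / 2) ^ v (a / m)`,
where `(a / -1)` is `-1` exactly when `a < 0`, `(a / 2)` is `0` for `a` even, `1` for
`a ≡ ± 1 mod 8` and `-1` for `a ≡ ± 3 mod 8` (that is, `ZMod.χ₈ a`), and `(a / m)` is the Jacobi
symbol. Moreover `(a / 0)` is `1` if `a = ± 1` and `0` otherwise. -/
def kroneckerSymbol (a n : ℤ) : ℤ :=
  if n = 0 then (if a.natAbs = 1 then 1 else 0)
  else (if n < 0 ∧ a < 0 then -1 else 1) *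
    (ZMod.χ₈ (a : ZMod 8)) ^ (n.natAbs.factorization 2) *
    jacobiSym a (n.natAbs / 2 ^ (n.natAbs.factorization 2))

/-- The space `M_k(Γ₀(N), χ)` of modular forms of weight `k`, level `N` and nebentypus `χ`:
the modular forms `f` of weight `k` for `Γ₁(N)` with
`f ((a z + b) / (c z + d)) = χ(d) (c z + d) ^ k f(z)`, that is `f ∣[k] γ = χ(d) f`,
for every `γ = (a, b; c, d)` in `Γ₀(N)`. -/
def modularFormsWithCharacter (N : ℕ) (χ : DirichletCharacter ℂ N) (k : ℤ) :
    Submodule ℂ (ModularForm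
      ((CongruenceSubgroup.Gamma1 N).map (Matrix.SpecialLinearGroup.mapGL ℝ)) k) where
  carrier := {f | ∀ γ ∈ CongruenceSubgroup.Gamma0 N,
    (⇑f : UpperHalfPlane → ℂ) ∣[k] γ = χ ((γ 1 1 : ℤ) : ZMod N) • (⇑f : UpperHalfPlane → ℂ)}
  zero_mem' := by
    intro γ _
    simp
  add_mem' := by
    intro f g hf hg γ hγ
    rw [FunLike.coe_add, SlashAction.add_slash, hf γ hγ, hg γ hγ, smul_add]
  smul_mem' := by
    intro c f hf γ hγ
    have h : (⇑(c • f) : UpperHalfPlane → ℂ) = c • ⇑f := rfl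
    rw [h, ModularForm.SL_smul_slash, hf γ hγ, smul_comm]

section TraceForm

variable (K : Type*) [Field K] [NumberField K]

/-- The set `O_K⁰` of integral elements of `K` with trace zero, as a `ℤ`-submodule of `𝓞 K`. -/
def traceZeroIntegers : Submodule ℤ (𝓞 K) where
  carrier := {x | Algebra.trace ℚ K (x : K) = 0}
  zero_mem' := by simp
  add_mem' := by
    intro x y hx hy
    simp only [Set.mem_ofPred_eq] at hx hy ⊢
    simp [hx, hy]
  smul_mem' := by
    intro n x hx
    simp only [Set.mem_ofPred_eq] at hx ⊢
    have h : ((n • x : 𝓞 K) : K) = n • (x : K) := by simp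
    rw [h, map_zsmul, hx, smul_zero]

/-- The scaled trace-zero form `t_K(x) = tr(x²) / (2 gcd(3, d))` on `O_K⁰`, where `d` is the
discriminant of `K`. -/
def scaledTraceForm (x : traceZeroIntegers K) : ℚ :=
  Algebra.trace ℚ K (((x : 𝓞 K) : K) ^ 2) / (2 * (Int.gcd 3 (NumberField.discr K) : ℚ))

/-- The term `q ^ t_K(x)`, with `q = exp(2πiz)`, of the theta series of `t_K`. -/
def thetaTerm (z : UpperHalfPlane) (x : traceZeroIntegers K) : ℂ :=
  Complex.exp (2 * Real.pi * Complex.I * (z : ℂ) * (scaledTraceForm K x : ℂ))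

/-- The theta series `f_K(z) = ∑_{x ∈ O_K⁰} q ^ t_K(x)`. -/
def thetaSeries (z : UpperHalfPlane) : ℂ :=
  ∑' x : traceZeroIntegers K, thetaTerm K z x

end TraceForm

end

/-! The scaled trace form is, in suitable coordinates, a positive definite integral binary quadratic
form of discriminant `d₃` (`exists_scaledTraceForm_eq_binaryForm`), and the theta series of such a
form of discriminant `D` has weight one, level `|D|` and character `(D/·)`
(`exists_modularForm_eq_binaryTheta`).

Arithmetic side: a fundamental discriminant is not divisible by 9, hence `27 ∤ d`, and this forces
an element `e` of trace 1. Then `𝓞 K = ℤe ⊕ O_K⁰`, and Cramer's rule for the Gram matrix, applied to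
the coordinates of 1, gives the form on `O_K⁰` determinant `3d` and makes it divisible by 3 when `3
∣ d`. It is even because the trace of a square is the square of the trace modulo 2.

Analytic side: Poisson summation expands the theta series near a rational point `r/s`, with
quadratic Gauss sums modulo `s` as coefficients (`binaryTheta_rat_add`). This yields boundedness at
all cusps. For matrices whose lower left entry is divisible by `|D|`, it also yields a
transformation law whose multiplier is a Gauss sum. Dirichlet's theorem on primes in progressions
reduces that multiplier to a prime modulus, where it is the quadratic character of `D`. -/

/-- The binary form `a x² + b x y + c y²`. -/
def binaryForm {R : Type*} [CommRing R] (a b c x y : R) : R :=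
  a * x ^ 2 + b * x * y + c * y ^ 2

/-! ### Poisson summation for binary Gaussian sums -/

section ThetaSum

open Complex

/-- This is Jacobi's functional equation for `jacobiTheta₂`: expanding the square turns the shift
`u` into the elliptic variable `s + T * u` and a constant factor. -/
lemma tsum_exp_gaussian_shift {T : ℂ} (hT : 0 < T.im) (s u : ℂ) :
    ∑' n : ℤ, cexp (2 * Real.pi * I * s * (n + u) + Real.pi * I * T * (n + u) ^ 2) =
      1 / (-I * T) ^ (1 / 2 : ℂ) *
        ∑' m : ℤ, cexp (2 * Real.pi * I * m * u - Real.pi * I * (m - s) ^ 2 / T) := by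
  have hT0 : T ≠ 0 := by rintro rfl; simp at hT
  have h1 : ∀ n : ℤ, cexp (2 * Real.pi * I * s * (n + u) + Real.pi * I * T * (n + u) ^ 2) =
      cexp (2 * Real.pi * I * s * u + Real.pi * I * T * u ^ 2) *
        jacobiTheta₂_term n (s + T * u) T := by
    intro n
    rw [jacobiTheta₂_term, ← Complex.exp_add]
    ring_nf
  simp_rw [h1]
  rw [tsum_mul_left, ← jacobiTheta₂, jacobiTheta₂_functional_equation, jacobiTheta₂]
  rw [← mul_assoc, ← mul_assoc, mul_comm (cexp _) (1 / _), mul_assoc, mul_assoc]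
  rw [← tsum_mul_left, ← tsum_mul_left]
  congr 1
  refine tsum_congr fun m => ?_
  rw [jacobiTheta₂_term, ← Complex.exp_add, ← Complex.exp_add]
  congr 1
  field_simp
  ring

/-- The least eigenvalue of the symmetric matrix `M` of the form is at least `det M / tr M`. By
Cayley–Hamilton the difference of the two sides is `|M(x, y)|²`, the sum of the two squares
supplied. -/
lemma mul_sq_add_sq_le_binaryForm (a b c x y : ℝ) :
    (4 * a * c - b ^ 2) / 4 * (x ^ 2 + y ^ 2) ≤ (a + c) * binaryForm a b c x y := by
  unfold binaryForm
  nlinarith [sq_nonneg (a * x + b / 2 * y), sq_nonneg (b / 2 * x + c * y)]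

lemma summable_exp_neg_mul_sq_shift {t : ℝ} (ht : 0 < t) (u : ℝ) :
    Summable fun n : ℤ => Real.exp (-t * (n + u) ^ 2) := by
  have h := ((summable_jacobiTheta₂_term_iff (u * (t / Real.pi) * I) (t / Real.pi * I)).2
    (by
      have : ((t : ℂ) / Real.pi * I) = ((t / Real.pi : ℝ) : ℂ) * I := by push_cast; ring
      rw [this]
      simp only [Complex.mul_im, Complex.ofReal_re, Complex.I_im, Complex.ofReal_im, Complex.I_re]
      have := div_pos ht Real.pi_pos
      simpa using this)).norm.mul_left (Real.exp (-t * u ^ 2))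
  refine h.congr fun n => ?_
  rw [jacobiTheta₂_term, Complex.norm_exp, ← Real.exp_add]
  congr 1
  have : (2 * (Real.pi : ℂ) * I * n * (u * (t / Real.pi) * I) +
      Real.pi * I * n ^ 2 * (t / Real.pi * I)) = ((-(2 * n * u * t) - n ^ 2 * t : ℝ) : ℂ) := by
    have hpi : (Real.pi : ℂ) ≠ 0 := by exact_mod_cast Real.pi_ne_zero
    push_cast
    field_simp
    linear_combination (2 * (n : ℂ) * u * t + n ^ 2 * t) * Complex.I_sq
  rw [this, Complex.ofReal_re]
  ring

lemma summable_exp_neg_binaryForm_shift {a b c : ℝ} (ha : 0 < a) (hN : 0 < 4 * a * c - b ^ 2)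
    {t : ℝ} (ht : 0 < t) (u v : ℝ) :
    Summable fun p : ℤ × ℤ => Real.exp (-t * binaryForm a b c (p.1 + u) (p.2 + v)) := by
  have hc : 0 < c := by
    by_contra! hc
    nlinarith [sq_nonneg b, mul_nonneg ha.le (neg_nonneg.2 hc)]
  set ε : ℝ := (4 * a * c - b ^ 2) / 4 / (a + c) with hε
  have hε0 : 0 < ε := by positivity
  refine Summable.of_nonneg_of_le (fun _ => (Real.exp_pos _).le) (fun p => ?_)
    ((summable_exp_neg_mul_sq_shift (mul_pos ht hε0) u).mul_of_nonneg
      (summable_exp_neg_mul_sq_shift (mul_pos ht hε0) v)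
      (fun _ => (Real.exp_pos _).le) (fun _ => (Real.exp_pos _).le))
  rw [← Real.exp_add, Real.exp_le_exp]
  have h := mul_sq_add_sq_le_binaryForm a b c (p.1 + u) (p.2 + v)
  have h2 : ε * ((p.1 + u) ^ 2 + (p.2 + v) ^ 2) ≤ binaryForm a b c (p.1 + u) (p.2 + v) := by
    rw [hε, div_mul_eq_mul_div, div_le_iff₀ (by positivity)]
    linarith
  nlinarith [mul_le_mul_of_nonneg_left h2 ht.le]

lemma norm_exp_two_pi_I_mul (τ : ℂ) (r : ℝ) :
    ‖cexp (2 * Real.pi * I * τ * r)‖ = Real.exp (-(2 * Real.pi * τ.im) * r) := by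
  rw [Complex.norm_exp]
  congr 1
  simp [Complex.mul_re, Complex.mul_im]

lemma summable_cexp_binaryForm_shift {a b c : ℝ} (ha : 0 < a) (hN : 0 < 4 * a * c - b ^ 2)
    {τ : ℂ} (hτ : 0 < τ.im) (u v : ℝ) :
    Summable fun p : ℤ × ℤ =>
      cexp (2 * Real.pi * I * τ * (binaryForm a b c (p.1 + u) (p.2 + v) : ℝ)) := by
  refine Summable.of_norm ?_
  simp_rw [norm_exp_two_pi_I_mul]
  exact summable_exp_neg_binaryForm_shift ha hN (by positivity) u v

lemma neg_inv_im_pos {τ : ℂ} (hτ : 0 < τ.im) : 0 < (-1 / τ).im := by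
  have h : 0 < normSq τ := normSq_pos.2 (by rintro rfl; simp at hτ)
  rw [neg_div, one_div, Complex.neg_im, Complex.inv_im, neg_div, neg_neg]
  positivity

/-- Positive real factors pass through the principal branch, so the two square roots from successive
one-variable summations combine without sign ambiguity. -/
lemma cpow_half_mul_cpow_half {τ : ℂ} (hτ : τ ≠ 0) {r s : ℝ} (hr : 0 < r) (hs : 0 < s) :
    (-I * (r * τ)) ^ (1 / 2 : ℂ) * (-I * (s * τ)) ^ (1 / 2 : ℂ) =
      (Real.sqrt (r * s) : ℂ) * (-I * τ) := by
  have h1 : ∀ t : ℝ, 0 < t → (-I * (t * τ)) ^ (1 / 2 : ℂ) =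
      (t : ℂ) ^ (1 / 2 : ℂ) * (-I * τ) ^ (1 / 2 : ℂ) := by
    intro t ht
    have hI : -I * τ ≠ 0 := by simpa using hτ
    have htC : (t : ℂ) ≠ 0 := by exact_mod_cast ht.ne'
    rw [show -I * (t * τ) = (t : ℂ) * (-I * τ) by ring,
      Complex.cpow_def_of_ne_zero (mul_ne_zero htC hI), Complex.log_ofReal_mul ht hI,
      Complex.ofReal_log ht.le, add_mul, Complex.exp_add, ← Complex.cpow_def_of_ne_zero htC,
      ← Complex.cpow_def_of_ne_zero hI]
  have h2 : (-I * τ) ^ (1 / 2 : ℂ) * (-I * τ) ^ (1 / 2 : ℂ) = -I * τ := by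
    rw [← Complex.cpow_add _ _ (by simpa using hτ)]
    norm_num
  have h3 : (r : ℂ) ^ (1 / 2 : ℂ) * (s : ℂ) ^ (1 / 2 : ℂ) = (Real.sqrt (r * s) : ℂ) := by
    rw [← Complex.mul_cpow_ofReal_nonneg hr.le hs.le, Real.sqrt_eq_rpow,
      Complex.ofReal_cpow (by positivity)]
    push_cast
    rfl
  rw [h1 r hr, h1 s hs, mul_mul_mul_comm, h2, h3]

set_option maxHeartbeats 800000 in
/-- Poisson summation for a positive definite binary quadratic form. -/
theorem tsum_cexp_binaryForm_shift {a b c : ℝ} (ha : 0 < a) (hN : 0 < 4 * a * c - b ^ 2)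
    {τ : ℂ} (hτ : 0 < τ.im) (u v : ℝ) :
    ∑' p : ℤ × ℤ, cexp (2 * Real.pi * I * τ * (binaryForm a b c (p.1 + u) (p.2 + v) : ℝ)) =
      1 / ((Real.sqrt (4 * a * c - b ^ 2) : ℂ) * (-I * τ)) *
        ∑' k : ℤ × ℤ, cexp (2 * Real.pi * I * (k.1 * u + k.2 * v)) *
          cexp (2 * Real.pi * I * (-1 / τ) *
            (binaryForm c (-b) a k.1 k.2 / (4 * a * c - b ^ 2) : ℝ)) := by
  have hτ0 : τ ≠ 0 := by rintro rfl; simp at hτ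
  have haC : (a : ℂ) ≠ 0 := by exact_mod_cast ha.ne'
  set N : ℝ := 4 * a * c - b ^ 2 with hNdef
  have hNC : (N : ℂ) ≠ 0 := by exact_mod_cast hN.ne'
  have hNeq : (N : ℂ) = 4 * a * c - b ^ 2 := by rw [hNdef]; push_cast; ring
  have hcpos : 0 < c := by
    by_contra! hc
    nlinarith [sq_nonneg b, mul_nonneg ha.le (neg_nonneg.2 hc)]
  have hT1 : 0 < (((2 * a : ℝ) : ℂ) * τ).im := by
    rw [Complex.im_ofReal_mul]; positivity
  have hT2 : 0 < (((N / (2 * a) : ℝ) : ℂ) * τ).im := by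
    rw [Complex.im_ofReal_mul]; positivity
  set C1 := 1 / (-I * (((2 * a : ℝ) : ℂ) * τ)) ^ (1 / 2 : ℂ) with hC1
  set C2 := 1 / (-I * (((N / (2 * a) : ℝ) : ℂ) * τ)) ^ (1 / 2 : ℂ) with hC2
  have hC : C1 * C2 = 1 / ((Real.sqrt N : ℂ) * (-I * τ)) := by
    rw [hC1, hC2, div_mul_div_comm, cpow_half_mul_cpow_half hτ0 (by positivity) (by positivity),
      mul_div_cancel₀ _ (by positivity : (2 * a) ≠ 0), one_mul]
  -- Completing the square, `Q = a (x + b y / (2a))² + N / (4a) y²`. `G y k` is the summand after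
  -- Poisson summation in `x` alone, `k` being dual to `x`.
  let G : ℤ → ℤ → ℂ := fun y k =>
    cexp (2 * Real.pi * I * k * u - Real.pi * I * k ^ 2 / (((2 * a : ℝ) : ℂ) * τ)) *
    cexp (2 * Real.pi * I * (k * b / (2 * a)) * (y + v) +
      Real.pi * I * (((N / (2 * a) : ℝ) : ℂ) * τ) * (y + v) ^ 2)
  have hinner : ∀ y : ℤ, ∑' x : ℤ,
      cexp (2 * Real.pi * I * τ * (binaryForm a b c (x + u) (y + v) : ℝ)) =
      C1 * ∑' k : ℤ, G y k := by
    intro y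
    have h := tsum_exp_gaussian_shift hT1 0 (u + b * (y + v) / (2 * a))
    have h2 : ∀ x : ℤ, cexp (2 * Real.pi * I * τ * (binaryForm a b c (x + u) (y + v) : ℝ)) =
        cexp (2 * Real.pi * I * 0 * (x + (u + b * (y + v) / (2 * a))) +
          Real.pi * I * (((2 * a : ℝ) : ℂ) * τ) * (x + (u + b * (y + v) / (2 * a))) ^ 2) *
        cexp (Real.pi * I * (((N / (2 * a) : ℝ) : ℂ) * τ) * (y + v) ^ 2) := by
      intro x
      rw [← Complex.exp_add]
      congr 1
      simp only [binaryForm]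
      push_cast
      rw [hNeq]
      field_simp
      ring
    simp_rw [h2]
    rw [tsum_mul_right, h, ← hC1, mul_assoc, ← tsum_mul_right]
    congr 1
    refine tsum_congr fun k => ?_
    simp only [G]
    rw [← Complex.exp_add, ← Complex.exp_add]
    congr 1
    push_cast
    field_simp
    ring
  -- The summand after the second Poisson summation, in `y`; the dual quadratic form appears.
  let H : ℤ → ℤ → ℂ := fun k m => cexp (2 * Real.pi * I * (k * u + m * v)) *
          cexp (2 * Real.pi * I * (-1 / τ) * (binaryForm c (-b) a k m / N : ℝ))
  have houter : ∀ k : ℤ, ∑' y : ℤ, G y k = C2 * ∑' m : ℤ, H k m := by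
    intro k
    have h := tsum_exp_gaussian_shift hT2 (k * b / (2 * a)) v
    simp only [G]
    rw [tsum_mul_left, h, ← hC2, mul_left_comm, ← tsum_mul_left]
    congr 1
    refine tsum_congr fun m => ?_
    simp only [H, binaryForm]
    rw [← Complex.exp_add, ← Complex.exp_add]
    congr 1
    push_cast
    field_simp
    rw [hNeq]
    ring
  have hsumF := summable_cexp_binaryForm_shift ha hN hτ u v
  have hsumH : Summable fun p : ℤ × ℤ => H p.1 p.2 := by
    refine Summable.of_norm ?_
    have h := summable_exp_neg_binaryForm_shift (a := c) (b := -b) (c := a) hcpos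
      (by rw [hNdef] at hN; linarith)
      (t := 2 * Real.pi * (-1 / τ).im / N)
      (by have := neg_inv_im_pos hτ; positivity) 0 0
    refine h.congr fun p => ?_
    simp only [H, norm_mul, norm_exp_two_pi_I_mul]
    rw [show (2 * Real.pi * I * ((p.1 : ℂ) * u + p.2 * v)) =
      ((2 * Real.pi * (p.1 * u + p.2 * v) : ℝ) : ℂ) * I by push_cast; ring,
      Complex.norm_exp_ofReal_mul_I, one_mul, add_zero, add_zero]
    congr 1
    ring
  -- The terms mixing `y` and `k` have purely imaginary exponent, so the norm of `G` is a product of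
  -- two one-variable Gaussians. This justifies exchanging the sums between the two Poisson steps.
  have hsumG : Summable fun p : ℤ × ℤ => G p.1 p.2 := by
    refine Summable.of_norm ?_
    have h1 := summable_exp_neg_mul_sq_shift
      (t := Real.pi * (((N / (2 * a) : ℝ) : ℂ) * τ).im) (by positivity) v
    have h2 := summable_exp_neg_mul_sq_shift
      (t := Real.pi / (2 * a) * (-1 / τ).im) (by have := neg_inv_im_pos hτ; positivity) 0
    refine (h1.mul_of_nonneg h2 (fun _ => (Real.exp_pos _).le)
      (fun _ => (Real.exp_pos _).le)).congr fun p => ?_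
    simp only [G, norm_mul, Complex.norm_exp]
    rw [mul_comm]
    congr 2
    · have : (2 * Real.pi * I * p.2 * u - Real.pi * I * (p.2 : ℂ) ^ 2 / (((2 * a : ℝ) : ℂ) * τ)) =
          ((2 * Real.pi * p.2 * u : ℝ) : ℂ) * I +
            ((Real.pi * p.2 ^ 2 / (2 * a) : ℝ) : ℂ) * (I * (-1 / τ)) := by
        push_cast; field_simp
        ring
      rw [this, Complex.add_re, Complex.re_ofReal_mul, Complex.re_ofReal_mul, Complex.I_re,
        Complex.I_mul_re]
      ring
    · have : (2 * Real.pi * I * (p.2 * b / (2 * a)) * (p.1 + v) +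
          Real.pi * I * (((N / (2 * a) : ℝ) : ℂ) * τ) * ((p.1 : ℂ) + v) ^ 2) =
          ((2 * Real.pi * (p.2 * b / (2 * a)) * (p.1 + v) : ℝ) : ℂ) * I +
            ((Real.pi * (p.1 + v) ^ 2 : ℝ) : ℂ) * (I * (((N / (2 * a) : ℝ) : ℂ) * τ)) := by
        push_cast; ring
      rw [this, Complex.add_re, Complex.re_ofReal_mul, Complex.re_ofReal_mul, Complex.I_re,
        Complex.I_mul_re]
      ring
  calc _ = ∑' y : ℤ, ∑' x : ℤ,
        cexp (2 * Real.pi * I * τ * (binaryForm a b c (x + u) (y + v) : ℝ)) := by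
        rw [← (Equiv.prodComm ℤ ℤ).tsum_eq]
        exact ((Equiv.prodComm ℤ ℤ).summable_iff.2 hsumF).tsum_prod
    _ = C1 * ∑' y : ℤ, ∑' k : ℤ, G y k := by simp_rw [hinner]; rw [tsum_mul_left]
    _ = C1 * ∑' k : ℤ, ∑' y : ℤ, G y k := by
        rw [Summable.tsum_comm (f := G) hsumG]
    _ = C1 * C2 * ∑' k : ℤ, ∑' m : ℤ, H k m := by
        simp_rw [houter]; rw [tsum_mul_left, mul_assoc]
    _ = _ := by rw [hC, hsumH.tsum_prod]

end ThetaSum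

/-! ### Expansion of the theta series at rational points -/

/-- The theta series of an integral binary quadratic form, as a function of a complex variable. -/
noncomputable def binaryTheta (a b c : ℤ) (τ : ℂ) : ℂ :=
  ∑' p : ℤ × ℤ, Complex.exp (2 * Real.pi * Complex.I * τ * (binaryForm a b c p.1 p.2 : ℤ))

/-- The Gauss sum modulo `s` of the polynomial `r (a x² + b x y + c y²) + k x + l y`. -/
noncomputable def binaryGaussSum (a b c : ℤ) (s : ℕ) [NeZero s] (r k l : ZMod s) : ℂ :=
  ∑ h : ZMod s × ZMod s,
    ZMod.stdAddChar (r * binaryForm (a : ZMod s) b c h.1 h.2 + (k * h.1 + l * h.2))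

/-- Division with remainder by `s`, the remainder being recorded as an element of `ZMod s`. -/
def Int.residueQuotientEquiv (s : ℕ) [NeZero s] : ZMod s × ℤ ≃ ℤ where
  toFun p := p.1.val + s * p.2
  invFun n := ((n : ZMod s), n / s)
  left_inv p := by
    have hs : (s : ℤ) ≠ 0 := by exact_mod_cast NeZero.ne s
    have hlt : (p.1.val : ℤ) < s := by exact_mod_cast p.1.val_lt
    ext
    · simp
    · simp only
      rw [Int.add_mul_ediv_left _ _ hs, Int.ediv_eq_zero_of_lt (by positivity) hlt, zero_add]
  right_inv n := by
    simp only [ZMod.val_intCast]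
    exact Int.emod_add_mul_ediv n s

section BinaryTheta

open Complex

lemma binaryForm_cast {R : Type*} [CommRing R] (a b c x y : ℤ) :
    ((binaryForm a b c x y : ℤ) : R) = binaryForm (a : R) b c x y := by
  simp [binaryForm]

lemma norm_binaryGaussSum_le (a b c : ℤ) (s : ℕ) [NeZero s] (r k l : ZMod s) :
    ‖binaryGaussSum a b c s r k l‖ ≤ (s : ℝ) ^ 2 := by
  refine (norm_sum_le _ _).trans ?_
  simp [AddChar.norm_apply, ZMod.card, sq]

lemma binaryTheta_summable {a b c : ℤ} (ha : 0 < a) (hN : 0 < 4 * a * c - b ^ 2)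
    {τ : ℂ} (hτ : 0 < τ.im) :
    Summable fun p : ℤ × ℤ => cexp (2 * Real.pi * I * τ * (binaryForm a b c p.1 p.2 : ℤ)) := by
  have h := summable_cexp_binaryForm_shift (a := a) (b := b) (c := c)
    (by exact_mod_cast ha) (by exact_mod_cast hN) hτ 0 0
  refine h.congr fun p => ?_
  simp [binaryForm]

/-- Split `ℤ²` into classes modulo `s`. On the class of `h`, the part `r / s` contributes a root of
unity depending only on `h`, and the rest is a shifted theta sum in `w * s ^ 2`. After Poisson
summation the shifts `h / s` become phases, and the sum over `h` assembles them into Gauss sums. -/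
lemma binaryTheta_rat_add {a b c : ℤ} (ha : 0 < a) (hN : 0 < 4 * a * c - b ^ 2)
    (s : ℕ) [NeZero s] (r : ℤ) {w : ℂ} (hw : 0 < w.im) :
    binaryTheta a b c (r / s + w) =
      1 / ((Real.sqrt (4 * a * c - b ^ 2) : ℂ) * (-I * (w * s ^ 2))) *
        ∑' k : ℤ × ℤ, binaryGaussSum a b c s r k.1 k.2 *
          cexp (2 * Real.pi * I * (-1 / (w * s ^ 2)) *
            (binaryForm (c : ℝ) (-b) a k.1 k.2 / (4 * a * c - b ^ 2) : ℝ)) := by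
  have haR : (0 : ℝ) < a := by exact_mod_cast ha
  have hNR : (0 : ℝ) < 4 * a * c - b ^ 2 := by exact_mod_cast hN
  have hcR : (0 : ℝ) < c := by
    by_contra! hc
    nlinarith [sq_nonneg (b : ℝ), mul_nonneg haR.le (neg_nonneg.2 hc)]
  have hs : (s : ℂ) ≠ 0 := by exact_mod_cast NeZero.ne s
  have hspos : (0 : ℝ) < s := by exact_mod_cast Nat.pos_of_ne_zero (NeZero.ne s)
  have hws : 0 < (w * s ^ 2).im := by
    have : (w * s ^ 2 : ℂ) = ((s ^ 2 : ℝ) : ℂ) * w := by push_cast; ring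
    rw [this, Complex.im_ofReal_mul]
    positivity
  have him : 0 < ((r : ℂ) / s + w).im := by
    have : ((r : ℂ) / s).im = 0 := by
      rw [show (r : ℂ) / s = ((r / s : ℝ) : ℂ) by push_cast; rfl, Complex.ofReal_im]
    rw [Complex.add_im, this, zero_add]
    exact hw
  set e : (ZMod s × ZMod s) × (ℤ × ℤ) ≃ ℤ × ℤ :=
    (Equiv.prodProdProdComm _ _ _ _).trans
      (Equiv.prodCongr (Int.residueQuotientEquiv s) (Int.residueQuotientEquiv s)) with he
  set E : ℤ × ℤ → ℂ := fun k => cexp (2 * Real.pi * I * (-1 / (w * s ^ 2)) *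
            (binaryForm (c : ℝ) (-b) a k.1 k.2 / (4 * a * c - b ^ 2) : ℝ)) with hE
  have hEs : Summable E := by
    refine Summable.of_norm ?_
    simp_rw [hE, norm_exp_two_pi_I_mul]
    refine (summable_exp_neg_binaryForm_shift (a := c) (b := -b) (c := a) hcR (by linarith)
      (t := 2 * Real.pi * (-1 / (w * s ^ 2)).im / (4 * a * c - b ^ 2))
      (by have := neg_inv_im_pos hws; positivity) 0 0).congr fun k => ?_
    simp only [add_zero]
    congr 1
    ring
  have hterm : ∀ (h : ZMod s × ZMod s) (q : ℤ × ℤ),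
      cexp (2 * Real.pi * I * (r / s + w) *
        (binaryForm a b c (e (h, q)).1 (e (h, q)).2 : ℤ)) =
      ZMod.stdAddChar ((r : ZMod s) * binaryForm (a : ZMod s) b c h.1 h.2) *
        cexp (2 * Real.pi * I * (w * s ^ 2) * (binaryForm (a : ℝ) b c
          (q.1 + (h.1.val / s : ℝ)) (q.2 + (h.2.val / s : ℝ)) : ℝ)) := by
    intro h q
    have h1 : ((r : ZMod s) * binaryForm (a : ZMod s) b c h.1 h.2) =
        ((r * binaryForm a b c (e (h, q)).1 (e (h, q)).2 : ℤ) : ZMod s) := by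
      simp [he, binaryForm, Int.residueQuotientEquiv, Equiv.prodProdProdComm]
    rw [h1, ZMod.stdAddChar_coe, ← Complex.exp_add]
    congr 1
    simp only [he, binaryForm, Int.residueQuotientEquiv, Equiv.prodProdProdComm, Equiv.trans_apply,
      Equiv.coe_fn_mk, Equiv.prodCongr_apply, Prod.map]
    push_cast
    field_simp
    ring
  have hsum := (e.summable_iff).2 (binaryTheta_summable ha hN him)
  rw [binaryTheta, ← e.tsum_eq]
  refine hsum.tsum_prod.trans ?_
  rw [tsum_fintype]
  simp only [Function.comp_apply]
  simp_rw [hterm, tsum_mul_left, tsum_cexp_binaryForm_shift haR hNR hws]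
  rw [← Finset.sum_congr rfl fun h _ => mul_left_comm _ _ _, ← Finset.mul_sum]
  congr 1
  simp_rw [← tsum_mul_left]
  rw [← Summable.tsum_finsetSum]
  · refine tsum_congr fun k => ?_
    rw [binaryGaussSum, Finset.sum_mul]
    refine Finset.sum_congr rfl fun h _ => ?_
    rw [AddChar.map_add_eq_mul, ← mul_assoc]
    congr 2
    have h1 : ((k.1 : ZMod s) * h.1 + k.2 * h.2) =
        ((k.1 * h.1.val + k.2 * h.2.val : ℤ) : ZMod s) := by simp
    rw [h1, ZMod.stdAddChar_coe]
    congr 1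
    push_cast
    field_simp
  · intro h _
    refine Summable.mul_left _ (Summable.of_norm (hEs.norm.congr fun k => ?_))
    rw [norm_mul]
    rw [show (2 * Real.pi * I * ((k.1 : ℂ) * ((h.1.val / s : ℝ) : ℂ) +
        k.2 * ((h.2.val / s : ℝ) : ℂ))) =
      ((2 * Real.pi * (k.1 * (h.1.val / s) + k.2 * (h.2.val / s)) : ℝ) : ℂ) * I by
        push_cast; ring, Complex.norm_exp_ofReal_mul_I, one_mul]

end BinaryTheta

/-! ### Binary Gauss sums modulo an odd prime -/

section GaussSums

variable {p : ℕ} [Fact p.Prime]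

/-- The complex valued quadratic character of `ZMod p`. -/
noncomputable def complexQuadraticChar (p : ℕ) [Fact p.Prime] : MulChar (ZMod p) ℂ :=
  (quadraticChar (ZMod p)).ringHomComp (Int.castRingHom ℂ)

lemma complexQuadraticChar_apply (t : ZMod p) :
    complexQuadraticChar p t = (quadraticChar (ZMod p) t : ℂ) := rfl

/-- Each `y` has `1 + χ(y)` square roots, and the constant 1 contributes a vanishing character sum.
-/
lemma sum_stdAddChar_mul_sq (hp : p ≠ 2) {t : ZMod p} (ht : t ≠ 0) :
    ∑ x : ZMod p, ZMod.stdAddChar (t * x ^ 2) =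
      complexQuadraticChar p t * gaussSum (complexQuadraticChar p) ZMod.stdAddChar := by
  have hchar : ringChar (ZMod p) ≠ 2 := by rwa [ZMod.ringChar_zmod_n]
  have h1 : ∑ x : ZMod p, ZMod.stdAddChar (t * x ^ 2) =
      ∑ y : ZMod p, (complexQuadraticChar p y + 1) * (ZMod.stdAddChar (t * y) : ℂ) := by
    rw [← Finset.sum_fiberwise _ (fun x : ZMod p => x ^ 2)]
    refine Finset.sum_congr rfl fun y _ => ?_
    rw [Finset.sum_congr rfl (g := fun _ => (ZMod.stdAddChar (t * y) : ℂ))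
      (fun x hx => by rw [(Finset.mem_filter.1 hx).2]), Finset.sum_const, nsmul_eq_mul]
    congr 1
    have h := quadraticChar_card_sqrts hchar y
    rw [complexQuadraticChar_apply]
    have h' : ((({x : ZMod p | x ^ 2 = y}.toFinset).card : ℤ) : ℂ) =
      ((quadraticChar (ZMod p) y + 1 : ℤ) : ℂ) := by rw [h]
    push_cast at h'
    rw [← h']
    congr 2
    ext x
    simp
  have h2 : ∑ y : ZMod p, (ZMod.stdAddChar (t * y) : ℂ) = 0 := by
    have h := AddChar.sum_mulShift (R := ZMod p) t (ZMod.isPrimitive_stdAddChar p)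
    rw [if_neg ht] at h
    simp_rw [mul_comm t]
    exact_mod_cast h
  have h3 := gaussSum_mulShift_eq (complexQuadraticChar p) ZMod.stdAddChar (Units.mk0 t ht)
  have hq : (complexQuadraticChar p).IsQuadratic :=
    (quadraticChar_isQuadratic (ZMod p)).comp _
  rw [hq.inv] at h3
  simp_rw [h1, add_mul, Finset.sum_add_distrib, one_mul, h2, add_zero]
  exact h3

/-- Completing the square diagonalises the form, with coefficients `r * a` and `-r * D / (4 * a)`.
The sum becomes a product of two one-variable Gauss sums, and `g² = χ(-1) p` removes the dependence
on the choice of `g`. -/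
lemma binaryGaussSum_eq (hp : p ≠ 2) {a b c : ℤ} {r : ZMod p} (hr : r ≠ 0)
    (ha : (a : ZMod p) ≠ 0) (hD : ((b ^ 2 - 4 * a * c : ℤ) : ZMod p) ≠ 0) :
    binaryGaussSum a b c p r 0 0 = p * (quadraticChar (ZMod p) (b ^ 2 - 4 * a * c : ℤ) : ℂ) := by
  have h2 : (2 : ZMod p) ≠ 0 := Ring.two_ne_zero (by rwa [ZMod.ringChar_zmod_n])
  have hchar : ringChar (ZMod p) ≠ 2 := by rwa [ZMod.ringChar_zmod_n]
  set D : ZMod p := ((b ^ 2 - 4 * a * c : ℤ) : ZMod p) with hDdef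
  have hD' : D = (b : ZMod p) ^ 2 - 4 * a * c := by rw [hDdef]; push_cast; ring
  set t : ZMod p := -(r * D) / (4 * a) with ht
  have h4 : (4 : ZMod p) ≠ 0 := by
    have : (4 : ZMod p) = 2 * 2 := by norm_num
    rw [this]
    exact mul_ne_zero h2 h2
  have ht0 : t ≠ 0 := div_ne_zero (neg_ne_zero.2 (mul_ne_zero hr hD)) (mul_ne_zero h4 ha)
  have hstep : binaryGaussSum a b c p r 0 0 =
      (∑ x : ZMod p, ZMod.stdAddChar (r * (a : ZMod p) * x ^ 2)) *
        ∑ y : ZMod p, (ZMod.stdAddChar (t * y ^ 2) : ℂ) := by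
    rw [binaryGaussSum, Fintype.sum_prod_type_right, Finset.mul_sum]
    refine Finset.sum_congr rfl fun y _ => ?_
    rw [← Equiv.sum_comp (Equiv.addRight ((b : ZMod p) * y / (2 * a)))
      (fun x : ZMod p => (ZMod.stdAddChar (r * (a : ZMod p) * x ^ 2) : ℂ)), Finset.sum_mul]
    refine Finset.sum_congr rfl fun x _ => ?_
    rw [← AddChar.map_add_eq_mul]
    congr 1
    simp only [binaryForm, Equiv.coe_addRight, ht, hD']
    field_simp
    ring
  have hq : (complexQuadraticChar p).IsQuadratic :=
    (quadraticChar_isQuadratic (ZMod p)).comp _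
  have hne : complexQuadraticChar p ≠ 1 := by
    intro h
    obtain ⟨u, hu⟩ := quadraticChar_exists_neg_one' hchar
    have := DFunLike.congr_fun h (u : ZMod p)
    rw [complexQuadraticChar_apply, hu, MulChar.one_apply u.isUnit] at this
    norm_num at this
  have hg := gaussSum_sq hne hq (ZMod.isPrimitive_stdAddChar p)
  rw [ZMod.card] at hg
  rw [hstep, sum_stdAddChar_mul_sq hp (mul_ne_zero hr ha), sum_stdAddChar_mul_sq hp ht0,
    mul_mul_mul_comm, ← sq, hg, ← mul_assoc, ← map_mul, ← map_mul, mul_comm]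
  congr 1
  -- The arguments of the characters multiply to a nonzero square times `D`, so `r` and `a` drop
  -- out.
  have : r * a * t * -1 = (r / 2) ^ 2 * D := by
    rw [ht]
    field_simp
    norm_num
  rw [this, map_mul, complexQuadraticChar_apply, complexQuadraticChar_apply,
    quadraticChar_sq_one' (div_ne_zero hr h2)]
  simp

end GaussSums

/-! ### Transformation law, growth at cusps and holomorphy -/

section BinaryThetaTransform

open Complex

lemma binaryTheta_add_int (a b c n : ℤ) (τ : ℂ) :
    binaryTheta a b c (τ + n) = binaryTheta a b c τ := by
  refine tsum_congr fun p => ?_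
  rw [Complex.exp_eq_exp_iff_exists_int]
  refine ⟨n * binaryForm a b c p.1 p.2, ?_⟩
  push_cast
  ring

lemma norm_binaryTheta_le {a b c : ℤ} (ha : 0 < a) (hN : 0 < 4 * a * c - b ^ 2)
    {τ : ℂ} (hτ : 1 ≤ τ.im) :
    ‖binaryTheta a b c τ‖ ≤
      ∑' p : ℤ × ℤ, Real.exp (-(2 * Real.pi) * binaryForm (a : ℝ) b c p.1 p.2) := by
  have haR : (0 : ℝ) < a := by exact_mod_cast ha
  have hNR : (0 : ℝ) < 4 * a * c - b ^ 2 := by exact_mod_cast hN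
  have hs := summable_exp_neg_binaryForm_shift haR hNR (t := 2 * Real.pi) (by positivity) 0 0
  simp only [add_zero] at hs
  refine tsum_of_norm_bounded hs.hasSum fun p => ?_
  have h := norm_exp_two_pi_I_mul τ (binaryForm a b c p.1 p.2 : ℤ)
  rw [Complex.ofReal_intCast] at h
  rw [h, binaryForm_cast, Real.exp_le_exp]
  have hQ : 0 ≤ binaryForm (a : ℝ) b c p.1 p.2 := by
    have h := mul_sq_add_sq_le_binaryForm (a : ℝ) b c p.1 p.2
    have hcR : (0 : ℝ) < c := by
      by_contra! hc
      nlinarith [sq_nonneg (b : ℝ), mul_nonneg haR.le (neg_nonneg.2 hc)]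
    have h0 : 0 ≤ ((a : ℝ) + c) * binaryForm (a : ℝ) b c p.1 p.2 := le_trans (by positivity) h
    exact nonneg_of_mul_nonneg_right h0 (by positivity)
  have := mul_le_mul_of_nonneg_left hτ (mul_nonneg Real.two_pi_pos.le hQ)
  linarith

/-- The matrix `(2a, b; b, 2c)` times its adjugate is the scalar `4ac - b²`, which `h` inverts
modulo `s`. Translating by `m` times the adjugate applied to `(k, l)` therefore removes the linear
term, leaving a constant given by the dual form. -/
lemma binaryGaussSum_mul_stdAddChar {a b c : ℤ} {s : ℕ} [NeZero s] {r m : ℤ}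
    (h : ((r * (m * (4 * a * c - b ^ 2)) : ℤ) : ZMod s) = -1) (k l : ℤ) :
    binaryGaussSum a b c s r k l * ZMod.stdAddChar ((-(m * binaryForm c (-b) a k l) : ℤ) : ZMod s) =
      binaryGaussSum a b c s r 0 0 := by
  rw [binaryGaussSum, binaryGaussSum, Finset.sum_mul,
    ← Equiv.sum_comp (Equiv.subRight
      (((m * (2 * c * k - b * l) : ℤ) : ZMod s), ((m * (2 * a * l - b * k) : ℤ) : ZMod s)))
      (fun x : ZMod s × ZMod s => (ZMod.stdAddChar
        ((r : ZMod s) * binaryForm (a : ZMod s) b c x.1 x.2 + (0 * x.1 + 0 * x.2)) : ℂ))]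
  refine Finset.sum_congr rfl fun x _ => ?_
  rw [← AddChar.map_add_eq_mul]
  congr 1
  simp only [Equiv.subRight_apply, Prod.fst_sub, Prod.snd_sub, binaryForm]
  push_cast at h ⊢
  linear_combination (-(k * x.1 + l * x.2) + (m : ZMod s) * (c * k ^ 2 - b * k * l + a * l ^ 2) :
    ZMod s) * (-h)

lemma binaryGaussSum_one (a b c : ℤ) (r k l : ZMod 1) : binaryGaussSum a b c 1 r k l = 1 := by
  simp [binaryGaussSum, Subsingleton.elim _ (0 : ZMod 1)]

lemma im_div_nat_add (r : ℤ) (s : ℕ) (w : ℂ) : ((r : ℂ) / s + w).im = w.im := by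
  have : ((r : ℂ) / s).im = 0 := by
    rw [show (r : ℂ) / s = ((r / s : ℝ) : ℂ) by push_cast; rfl, Complex.ofReal_im]
  rw [Complex.add_im, this, zero_add]

lemma denom_ne_zero_of_im_pos {τ : ℂ} (hτ : 0 < τ.im) {C E : ℤ} (h : C ≠ 0 ∨ E ≠ 0) :
    (C : ℂ) * τ + E ≠ 0 := by
  intro h0
  have him := congrArg Complex.im h0
  simp [Complex.mul_im, hτ.ne'] at him
  subst him
  simp at h0
  simp [h0] at h

/-- The transformation law for matrices whose lower right entry is positive. -/
theorem binaryTheta_transform {a b c : ℤ} (ha : 0 < a) (hN : 0 < 4 * a * c - b ^ 2)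
    {A B C : ℤ} {s : ℕ} [NeZero s] (hdet : A * s - B * C = 1) (hC : (4 * a * c - b ^ 2) ∣ C)
    {τ : ℂ} (hτ : 0 < τ.im) (him : 0 < ((A * τ + B) / (C * τ + s)).im) :
    binaryTheta a b c ((A * τ + B) / (C * τ + s)) =
      (C * τ + s) * (binaryGaussSum a b c s B 0 0 / s) * binaryTheta a b c τ := by
  have hs : (s : ℂ) ≠ 0 := by exact_mod_cast NeZero.ne s
  have hτ0 : τ ≠ 0 := by rintro rfl; simp at hτ
  have hden : (C : ℂ) * τ + s ≠ 0 := by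
    have := denom_ne_zero_of_im_pos hτ (C := C) (E := s) (Or.inr (by exact_mod_cast NeZero.ne s))
    exact_mod_cast this
  have hdetC : (A : ℂ) * s - B * C = 1 := by exact_mod_cast hdet
  obtain ⟨m, hm⟩ := hC
  have hNC : (4 * a * c - b ^ 2 : ℂ) ≠ 0 := by exact_mod_cast hN.ne'
  have hmC : (C : ℂ) = (4 * a * c - b ^ 2) * m := by exact_mod_cast congrArg (Int.cast (R := ℂ)) hm
  have hsqrt : (Real.sqrt (4 * a * c - b ^ 2) : ℂ) ≠ 0 := by
    rw [Complex.ofReal_ne_zero, Real.sqrt_ne_zero']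
    exact_mod_cast hN
  set w : ℂ := τ / (s * (C * τ + s)) with hw
  have hsplit : (A * τ + B) / (C * τ + s) = B / s + w := by
    rw [hw, div_add_div _ _ hs (mul_ne_zero hs hden), div_eq_div_iff hden (mul_ne_zero hs (mul_ne_zero hs hden))]
    linear_combination s * (C * τ + s) * τ * hdetC
  have hwim : 0 < w.im := by rwa [hsplit, im_div_nat_add] at him
  -- The dual variable is `-1 / τ` up to a rational translation, so the dual sum is the one for `τ`
  -- twisted by phases of denominator `s`.
  have hw' : -1 / (w * s ^ 2) = -C / s + -1 / τ := by
    rw [hw]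
    field_simp
    ring
  have hgauss : (((B * (m * (4 * a * c - b ^ 2)) : ℤ)) : ZMod s) = -1 := by
    have h := congrArg (Int.cast (R := ZMod s)) hdet
    rw [hm] at h
    push_cast at h ⊢
    rw [ZMod.natCast_self] at h
    linear_combination -h
  -- With `r = 0`, `s = 1` the same expansion describes the theta series at `τ`; the two dual sums
  -- are then compared term by term.
  have h1 := binaryTheta_rat_add ha hN 1 0 hτ
  have hz : ((0 : ℤ) : ℂ) / ((1 : ℕ) : ℂ) + τ = τ := by simp
  rw [hz] at h1
  simp only [binaryGaussSum_one, Nat.cast_one, one_pow, mul_one, one_mul] at h1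
  rw [hsplit, binaryTheta_rat_add ha hN s B hwim, h1]
  -- Since `C = m (4ac - b²)`, the phase from `-C / s` is exactly the one that turns the Gauss sum
  -- at `k` into the Gauss sum at 0.
  have hterm : ∀ k : ℤ × ℤ, binaryGaussSum a b c s B k.1 k.2 *
      cexp (2 * Real.pi * I * (-1 / (w * s ^ 2)) *
            (binaryForm (c : ℝ) (-b) a k.1 k.2 / (4 * a * c - b ^ 2) : ℝ)) =
      binaryGaussSum a b c s B 0 0 * cexp (2 * Real.pi * I * (-1 / τ) *
            (binaryForm (c : ℝ) (-b) a k.1 k.2 / (4 * a * c - b ^ 2) : ℝ)) := by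
    intro k
    rw [← binaryGaussSum_mul_stdAddChar hgauss k.1 k.2, mul_assoc (binaryGaussSum a b c s B k.1 k.2),
      ZMod.stdAddChar_coe, ← Complex.exp_add, hw']
    congr 2
    simp only [binaryForm]
    push_cast
    rw [hmC]
    field_simp
  simp_rw [hterm, tsum_mul_left]
  rw [hw]
  field_simp

/-- Boundedness at the cusp `A / C`. -/
lemma norm_binaryTheta_transform_le_of_pos {a b c : ℤ} (ha : 0 < a) (hN : 0 < 4 * a * c - b ^ 2)
    {A B E : ℤ} {s : ℕ} [NeZero s] (hdet : A * E - B * s = 1) :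
    ∃ M : ℝ, ∀ τ : ℂ, 1 ≤ τ.im → 0 < ((A * τ + B) / (s * τ + E)).im →
      ‖binaryTheta a b c ((A * τ + B) / (s * τ + E)) / (s * τ + E)‖ ≤ M := by
  have haR : (0 : ℝ) < a := by exact_mod_cast ha
  have hNR : (0 : ℝ) < 4 * a * c - b ^ 2 := by exact_mod_cast hN
  have hcR : (0 : ℝ) < c := by
    by_contra! hc
    nlinarith [sq_nonneg (b : ℝ), mul_nonneg haR.le (neg_nonneg.2 hc)]
  have hs : (s : ℂ) ≠ 0 := by exact_mod_cast NeZero.ne s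
  have hsum := summable_exp_neg_binaryForm_shift (a := c) (b := -b) (c := a) hcR (by linarith)
      (t := 2 * Real.pi / (4 * a * c - b ^ 2)) (by positivity) 0 0
  simp only [add_zero] at hsum
  refine ⟨1 / (Real.sqrt (4 * a * c - b ^ 2) * s) * ((s : ℝ) ^ 2 * ∑' k : ℤ × ℤ, Real.exp
    (-(2 * Real.pi / (4 * a * c - b ^ 2)) * binaryForm (c : ℝ) (-b) a k.1 k.2)),
    fun τ hτ1 him => ?_⟩
  have hτ : 0 < τ.im := by linarith
  have hden : (s : ℂ) * τ + E ≠ 0 := by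
    have := denom_ne_zero_of_im_pos hτ (C := s) (E := E) (Or.inl (by exact_mod_cast NeZero.ne s))
    exact_mod_cast this
  have hdetC : (A : ℂ) * E - B * s = 1 := by exact_mod_cast hdet
  set w : ℂ := -1 / (s * (s * τ + E)) with hw
  have hsplit : (A * τ + B) / (s * τ + E) = A / s + w := by
    rw [hw, div_add_div _ _ hs (mul_ne_zero hs hden), div_eq_div_iff hden
      (mul_ne_zero hs (mul_ne_zero hs hden))]
    linear_combination -(s * (s * τ + E)) * hdetC
  have hwim : 0 < w.im := by rwa [hsplit, im_div_nat_add] at him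
  -- The dual variable has the imaginary part of `τ`, so the dual sum is dominated by its value at
  -- height 1, with Gauss sums at most `s²`. The factor `1 / w` cancels against the division by `s *
  -- τ + E`, leaving a constant modulus.
  have hw' : -1 / (w * s ^ 2) = E / s + τ := by
    rw [hw]
    field_simp
    ring
  have hpref : ‖1 / ((Real.sqrt (4 * a * c - b ^ 2) : ℂ) * (-I * (w * s ^ 2))) / (s * τ + E)‖ =
      1 / (Real.sqrt (4 * a * c - b ^ 2) * s) := by
    have : 1 / ((Real.sqrt (4 * a * c - b ^ 2) : ℂ) * (-I * (w * s ^ 2))) / (s * τ + E) =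
        1 / ((Real.sqrt (4 * a * c - b ^ 2) : ℂ) * s) * (1 / I) := by
      rw [hw]
      field_simp
    rw [this, norm_mul, norm_div, norm_div, norm_mul, Complex.norm_I, norm_one,
      Complex.norm_real, Complex.norm_natCast, Real.norm_of_nonneg (Real.sqrt_nonneg _)]
    simp
  rw [hsplit, binaryTheta_rat_add ha hN s A hwim, mul_div_right_comm, norm_mul, hpref]
  refine mul_le_mul_of_nonneg_left ?_ (by positivity)
  refine tsum_of_norm_bounded (hsum.hasSum.mul_left _) fun k => ?_
  rw [norm_mul, hw', norm_exp_two_pi_I_mul, im_div_nat_add]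
  refine mul_le_mul (norm_binaryGaussSum_le ..) ?_ (Real.exp_pos _).le (by positivity)
  rw [Real.exp_le_exp]
  have hQ : 0 ≤ binaryForm (c : ℝ) (-b) a k.1 k.2 := by
    have h := mul_sq_add_sq_le_binaryForm (c : ℝ) (-b) a k.1 k.2
    have h4 : 0 < 4 * (c : ℝ) * a - (-b) ^ 2 := by linarith
    have h0 : 0 ≤ ((c : ℝ) + a) * binaryForm (c : ℝ) (-b) a k.1 k.2 := le_trans (by positivity) h
    exact nonneg_of_mul_nonneg_right h0 (by positivity)
  have := mul_le_mul_of_nonneg_left hτ1 (div_nonneg (mul_nonneg Real.two_pi_pos.le hQ) hNR.le)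
  calc _ = -(2 * Real.pi * binaryForm (c : ℝ) (-b) a k.1 k.2 / (4 * a * c - b ^ 2) * τ.im) := by
        ring
    _ ≤ -(2 * Real.pi * binaryForm (c : ℝ) (-b) a k.1 k.2 / (4 * a * c - b ^ 2) * 1) :=
        neg_le_neg this
    _ = _ := by ring

lemma norm_binaryTheta_transform_le {a b c : ℤ} (ha : 0 < a) (hN : 0 < 4 * a * c - b ^ 2)
    {A B C E : ℤ} (hdet : A * E - B * C = 1) :
    ∃ M : ℝ, ∀ τ : ℂ, 1 ≤ τ.im → 0 < ((A * τ + B) / (C * τ + E)).im →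
      ‖binaryTheta a b c ((A * τ + B) / (C * τ + E)) / (C * τ + E)‖ ≤ M := by
  rcases lt_trichotomy C 0 with hC | hC | hC
  · obtain ⟨s, rfl⟩ : ∃ s : ℕ, C = -(s : ℤ) := ⟨(-C).toNat, by omega⟩
    have : NeZero s := ⟨by rintro rfl; simp at hC⟩
    obtain ⟨M, hM⟩ := norm_binaryTheta_transform_le_of_pos ha hN (A := -A) (B := -B) (E := -E)
      (s := s) (by linarith)
    refine ⟨M, fun τ h1 h2 => ?_⟩
    have e1 : (s : ℂ) * τ + (-E : ℤ) = -(((-(s : ℤ) : ℤ) : ℂ) * τ + E) := by push_cast; ring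
    have e2 : ((-A : ℤ) : ℂ) * τ + (-B : ℤ) = -((A : ℂ) * τ + B) := by push_cast; ring
    have h := hM τ h1
    rw [e1, e2, neg_div_neg_eq, div_neg, norm_neg] at h
    exact h h2
  · subst hC
    refine ⟨∑' p : ℤ × ℤ, Real.exp (-(2 * Real.pi) * binaryForm (a : ℝ) b c p.1 p.2),
      fun τ h1 _ => ?_⟩
    rcases Int.mul_eq_one_iff_eq_one_or_neg_one.1 (by linarith : A * E = 1) with ⟨rfl, rfl⟩ |
      ⟨rfl, rfl⟩
    · have : ((1 : ℤ) * τ + B) / (((0 : ℤ) : ℂ) * τ + (1 : ℤ)) = τ + B := by simp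
      rw [this, binaryTheta_add_int]
      simpa using norm_binaryTheta_le ha hN h1
    · have : (((-1 : ℤ) : ℂ) * τ + B) / (((0 : ℤ) : ℂ) * τ + (-1 : ℤ)) = τ + (-B : ℤ) := by
        push_cast; ring
      rw [this, binaryTheta_add_int]
      simpa using norm_binaryTheta_le ha hN h1
  · obtain ⟨s, rfl⟩ : ∃ s : ℕ, C = (s : ℤ) := ⟨C.toNat, by omega⟩
    have : NeZero s := ⟨by rintro rfl; simp at hC⟩
    simpa using norm_binaryTheta_transform_le_of_pos ha hN hdet

lemma differentiableOn_binaryTheta {a b c : ℤ} (ha : 0 < a) (hN : 0 < 4 * a * c - b ^ 2) :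
    DifferentiableOn ℂ (binaryTheta a b c) {τ | 0 < τ.im} := by
  have haR : (0 : ℝ) < a := by exact_mod_cast ha
  have hNR : (0 : ℝ) < 4 * a * c - b ^ 2 := by exact_mod_cast hN
  have hcR : (0 : ℝ) < c := by
    by_contra! hc
    nlinarith [sq_nonneg (b : ℝ), mul_nonneg haR.le (neg_nonneg.2 hc)]
  intro τ₀ hτ₀
  rw [Set.mem_ofPred_eq] at hτ₀
  have hs := summable_exp_neg_binaryForm_shift haR hNR (t := 2 * Real.pi * (τ₀.im / 2))
    (by positivity) 0 0
  simp only [add_zero] at hs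
  -- On this half plane the terms are dominated by their size at height `τ₀.im / 2`, which gives
  -- uniform convergence near `τ₀`.
  have hopen : IsOpen {τ : ℂ | τ₀.im / 2 < τ.im} := isOpen_lt continuous_const Complex.continuous_im
  have hd : DifferentiableOn ℂ (binaryTheta a b c) {τ | τ₀.im / 2 < τ.im} := by
    refine Complex.differentiableOn_tsum_of_summable_norm hs (fun p => ?_) hopen
      (fun p τ hτ => ?_)
    · fun_prop
    · have h := norm_exp_two_pi_I_mul τ (binaryForm a b c p.1 p.2 : ℤ)
      rw [Complex.ofReal_intCast] at h
      rw [h, binaryForm_cast, Real.exp_le_exp]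
      have hQ : 0 ≤ binaryForm (a : ℝ) b c p.1 p.2 := by
        have h := mul_sq_add_sq_le_binaryForm (a : ℝ) b c p.1 p.2
        have h0 : 0 ≤ ((a : ℝ) + c) * binaryForm (a : ℝ) b c p.1 p.2 := le_trans (by positivity) h
        exact nonneg_of_mul_nonneg_right h0 (by positivity)
      have := mul_le_mul_of_nonneg_left (le_of_lt hτ : τ₀.im / 2 ≤ τ.im)
        (mul_nonneg Real.two_pi_pos.le hQ)
      linarith
  exact (hd.differentiableAt (hopen.mem_nhds (by simpa using hτ₀))).differentiableWithinAt

end BinaryThetaTransform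

/-! ### The Kronecker symbol as a Dirichlet character -/

section Kronecker

open NumberTheorySymbols

lemma exists_dirichletCharacter_of_periodic {N : ℕ} [NeZero N] (f : ℕ → ℤ) (hone : f 1 = 1)
    (hmul : ∀ m n, f (m * n) = f m * f n) (hmod : ∀ n, f (n % N) = f n)
    (hzero : ∀ n, ¬ n.Coprime N → f n = 0) :
    ∃ χ : DirichletCharacter ℂ N, ∀ n : ℕ, χ (n : ZMod N) = f n := by
  refine ⟨{ toFun := fun x => (f x.val : ℂ), map_one' := ?_, map_mul' := ?_, map_nonunit' := ?_ },
    fun n => ?_⟩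
  · rw [ZMod.val_one_eq_one_mod, hmod, hone, Int.cast_one]
  · intro x y
    rw [ZMod.val_mul, hmod, hmul, Int.cast_mul]
  · intro x hx
    rw [hzero, Int.cast_zero]
    rwa [← ZMod.isUnit_iff_coprime, ZMod.natCast_zmod_val]
  · change (f (n : ZMod N).val : ℂ) = f n
    rw [ZMod.val_natCast, hmod]

lemma kroneckerSymbol_neg {D : ℤ} (hD : D < 0) {n : ℕ} (hn : n ≠ 0) :
    kroneckerSymbol D (-(n : ℤ)) = -kroneckerSymbol D n := by
  have h1 : (-(n : ℤ)) < 0 := by omega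
  have h2 : ¬ ((n : ℤ) < 0) := by omega
  have h3 : (n : ℤ) ≠ 0 := by exact_mod_cast hn
  rw [kroneckerSymbol, kroneckerSymbol, if_neg (neg_ne_zero.2 h3), if_neg h3,
    if_pos ⟨h1, hD⟩, if_neg (fun h => h2 h.1), Int.natAbs_neg]
  ring

lemma kroneckerSymbol_natCast (D : ℤ) {n : ℕ} (hn : n ≠ 0) :
    kroneckerSymbol D n = (ZMod.χ₈ (D : ZMod 8)) ^ (n.factorization 2) *
      J(D | n / 2 ^ (n.factorization 2)) := by
  have h2 : ¬ ((n : ℤ) < 0) := by omega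
  have h3 : (n : ℤ) ≠ 0 := by exact_mod_cast hn
  rw [kroneckerSymbol, if_neg h3, if_neg (fun h => h2 h.1), one_mul, Int.natAbs_natCast]

lemma kroneckerSymbol_odd (D : ℤ) {n : ℕ} (hn : Odd n) : kroneckerSymbol D n = J(D | n) := by
  have h0 : n ≠ 0 := by rintro rfl; simp at hn
  have hf : n.factorization 2 = 0 :=
    Nat.factorization_eq_zero_of_not_dvd (by rwa [← even_iff_two_dvd, Nat.not_even_iff_odd])
  rw [kroneckerSymbol_natCast D h0, hf]
  simp

lemma kroneckerSymbol_prime {D : ℤ} {p : ℕ} [Fact p.Prime] (hp : p ≠ 2) :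
    kroneckerSymbol D p = quadraticChar (ZMod p) D := by
  rw [kroneckerSymbol_odd D ((Fact.out : p.Prime).odd_of_ne_two hp),
    ← jacobiSym.legendreSym.to_jacobiSym]
  rfl

lemma kroneckerSymbol_zero {D : ℤ} (hD : D.natAbs ≠ 1) : kroneckerSymbol D 0 = 0 := by
  simp [kroneckerSymbol, hD]

/-- Quadratic reciprocity, with `D = -N` and `N ≡ 3 mod 4`: the sign `(-1/m)` cancels the
reciprocity sign, and the power of 2 is handled by the supplementary law. Periodicity modulo `|D|`
becomes visible on the right. -/
lemma kroneckerSymbol_eq_jacobiSym {D : ℤ} (hD : D < 0) (h4 : D % 4 = 1) (n : ℕ) :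
    kroneckerSymbol D n = J(n | D.natAbs) := by
  obtain ⟨N, rfl⟩ : ∃ N : ℕ, D = -(N : ℤ) := ⟨D.natAbs, by omega⟩
  have hN4 : N % 4 = 3 := by omega
  have hNodd : Odd N := Nat.odd_iff.2 (by omega)
  rw [Int.natAbs_neg, Int.natAbs_natCast]
  rcases eq_or_ne n 0 with rfl | hn
  · rw [Nat.cast_zero, kroneckerSymbol_zero (by omega), jacobiSym.zero_left (by omega)]
  rw [kroneckerSymbol_natCast _ hn]
  set v := n.factorization 2
  set m := n / 2 ^ v with hm
  have hmodd : Odd m := by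
    rw [← Nat.not_even_iff_odd, even_iff_two_dvd]
    exact Nat.not_dvd_ordCompl Nat.prime_two hn
  have hnm : n = 2 ^ v * m := (Nat.ordProj_mul_ordCompl_eq_self n 2).symm
  have h8 : ZMod.χ₈ (-(N : ZMod 8)) = J(2 | N) := by
    rw [jacobiSym.at_two hNodd]
    generalize ((N : ℕ) : ZMod 8) = x
    revert x
    decide
  conv_rhs => rw [hnm]
  push_cast
  rw [jacobiSym.mul_left, jacobiSym.pow_left, h8]
  congr 1
  rw [jacobiSym.neg _ hmodd]
  rcases Nat.odd_mod_four_iff.1 (Nat.odd_iff.1 hmodd) with h | h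
  · rw [ZMod.χ₄_nat_one_mod_four h, one_mul, jacobiSym.quadratic_reciprocity_one_mod_four h hNodd]
  · rw [ZMod.χ₄_nat_three_mod_four h, jacobiSym.quadratic_reciprocity_three_mod_four h hN4]
    ring

lemma kroneckerSymbol_even {D : ℤ} (hD : D % 4 = 0) {n : ℕ} (hn : Even n) :
    kroneckerSymbol D n = 0 := by
  rcases eq_or_ne n 0 with rfl | h0
  · exact kroneckerSymbol_zero (by omega)
  have hv : n.factorization 2 ≠ 0 :=
    (Nat.Prime.factorization_pos_of_dvd Nat.prime_two h0 (even_iff_two_dvd.1 hn)).ne'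
  rw [kroneckerSymbol_natCast D h0, ZMod.χ₈_int_eq_if_mod_eight, if_pos (by omega), zero_pow hv,
    zero_mul]

lemma jacobiSym_neg_four_mul_sub_one {k : ℕ} (hk : 0 < k) : J(-(4 * k : ℤ) | 4 * k - 1) = -1 := by
  have hodd : Odd (4 * k - 1) := Nat.odd_iff.2 (by omega)
  rw [jacobiSym.neg _ hodd, ZMod.χ₄_nat_three_mod_four (by omega)]
  have : J((4 * k : ℤ) | 4 * k - 1) = J(1 | 4 * k - 1) := by
    exact jacobiSym.mod_left' ((Int.modEq_iff_dvd).2 ⟨-1, by omega⟩)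
  rw [this, jacobiSym.one_left, mul_one]

/-- The Kronecker symbol of a negative integer `D ≡ 0, 1 mod 4` is a Dirichlet character. -/
theorem exists_dirichletCharacter_kroneckerSymbol {D : ℤ} (hD : D < 0)
    (h4 : D % 4 = 0 ∨ D % 4 = 1) :
    ∃ χ : DirichletCharacter ℂ D.natAbs,
      ∀ n : ℤ, χ (n : ZMod D.natAbs) = (kroneckerSymbol D n : ℂ) := by
  have : NeZero D.natAbs := ⟨by omega⟩
  -- The character is first matched on natural numbers. The value at `|D| - 1 ≡ -1` gives `χ (-1) =
  -- -1`, which agrees with the sign of the symbol at negative arguments.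
  have key : ∃ χ : DirichletCharacter ℂ D.natAbs,
      (∀ n : ℕ, χ (n : ZMod D.natAbs) = (kroneckerSymbol D n : ℂ)) ∧
        kroneckerSymbol D (D.natAbs - 1 : ℕ) = -1 := by
    rcases h4 with h4 | h4
    · obtain ⟨k, hk⟩ : ∃ k : ℕ, D = -(4 * k : ℤ) := ⟨D.natAbs / 4, by omega⟩
      have hkpos : 0 < k := by omega
      have hN : D.natAbs = 4 * k := by omega
      have hJ : ∀ n : ℕ, Odd n → kroneckerSymbol D n = J(-(k : ℤ) | n) := by
        intro n hn
        rw [kroneckerSymbol_odd D hn, hk, show -(4 * k : ℤ) = 4 * (-(k : ℤ)) by ring,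
          jacobiSym.mul_left, jacobiSym.at_four hn, one_mul]
      have hχ : ∃ χ : DirichletCharacter ℂ D.natAbs,
          ∀ n : ℕ, χ (n : ZMod D.natAbs) = (kroneckerSymbol D n : ℂ) := by
        refine exists_dirichletCharacter_of_periodic (fun n => kroneckerSymbol D n) ?_ ?_ ?_ ?_
        · rw [hJ 1 odd_one, jacobiSym.one_right]
        · intro m n
          rcases Nat.even_or_odd m with hm | hm
          · rw [kroneckerSymbol_even h4 hm, kroneckerSymbol_even h4 (hm.mul_right n), zero_mul]
          rcases Nat.even_or_odd n with hn | hn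
          · rw [kroneckerSymbol_even h4 hn, kroneckerSymbol_even h4 (hn.mul_left m), mul_zero]
          have : NeZero m := ⟨by rintro rfl; simp at hm⟩
          have : NeZero n := ⟨by rintro rfl; simp at hn⟩
          rw [hJ m hm, hJ n hn, hJ _ (hm.mul hn), jacobiSym.mul_right]
        · intro n
          rw [hN]
          have h2 : n % (4 * k) % 2 = n % 2 := Nat.mod_mod_of_dvd _ ⟨2 * k, by ring⟩
          rcases Nat.even_or_odd n with hn | hn
          · rw [kroneckerSymbol_even h4 hn, kroneckerSymbol_even h4]
            rw [Nat.even_iff, h2, Nat.even_iff.1 hn]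
          · rw [hJ n hn, hJ _ (by rw [Nat.odd_iff, h2, Nat.odd_iff.1 hn]),
              jacobiSym.mod_right _ hn, Int.natAbs_neg, Int.natAbs_natCast]
        · intro n hn
          rcases Nat.even_or_odd n with he | ho
          · exact kroneckerSymbol_even h4 he
          · rw [kroneckerSymbol_odd D ho, jacobiSym.eq_zero_iff]
            refine ⟨by rintro rfl; simp at ho, ?_⟩
            rwa [Int.gcd, Int.natAbs_natCast, Nat.gcd_comm]
      obtain ⟨χ, hχ⟩ := hχ
      refine ⟨χ, hχ, ?_⟩
      rw [hN, kroneckerSymbol_odd D (Nat.odd_iff.2 (by omega)), hk,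
        jacobiSym_neg_four_mul_sub_one hkpos]
    · have hJ := kroneckerSymbol_eq_jacobiSym hD h4
      have hN4 : D.natAbs % 4 = 3 := by omega
      have hχ : ∃ χ : DirichletCharacter ℂ D.natAbs,
          ∀ n : ℕ, χ (n : ZMod D.natAbs) = (kroneckerSymbol D n : ℂ) := by
        refine exists_dirichletCharacter_of_periodic (fun n => kroneckerSymbol D n) ?_ ?_ ?_ ?_
        · rw [hJ, Nat.cast_one, jacobiSym.one_left]
        · intro m n
          rw [hJ, hJ, hJ, Nat.cast_mul, jacobiSym.mul_left]
        · intro n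
          rw [hJ, hJ, Int.natCast_mod, ← jacobiSym.mod_left]
        · intro n hn
          rw [hJ, jacobiSym.eq_zero_iff]
          exact ⟨by omega, hn⟩
      obtain ⟨χ, hχ⟩ := hχ
      refine ⟨χ, hχ, ?_⟩
      rw [hJ, jacobiSym.mod_left' (a₂ := -1),
        jacobiSym.at_neg_one (Nat.odd_iff.2 (by omega)), ZMod.χ₄_nat_three_mod_four hN4]
      exact Int.ModEq.symm ((Int.modEq_iff_dvd).2 ⟨1, by omega⟩)
  obtain ⟨χ, hχ, hneg⟩ := key
  refine ⟨χ, fun n => ?_⟩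
  have hχneg : χ (-1) = -1 := by
    have h := hχ (D.natAbs - 1)
    rw [hneg, Nat.cast_sub (by omega), ZMod.natCast_self] at h
    simpa using h
  obtain ⟨m, rfl | rfl⟩ := Int.eq_nat_or_neg n
  · simpa using hχ m
  · rcases eq_or_ne m 0 with rfl | hm
    · simpa using hχ 0
    · rw [kroneckerSymbol_neg hD hm, Int.cast_neg, Int.cast_natCast, ← neg_one_mul, map_mul, hχneg,
        hχ, Int.cast_neg, neg_one_mul]

end Kronecker

/-! ### Binary theta series as modular forms with character -/

section BinaryThetaModularForm

open UpperHalfPlane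

/-- The theta series of a binary quadratic form on the upper half plane. -/
noncomputable def binaryThetaUHP (a b c : ℤ) (z : ℍ) : ℂ :=
  binaryTheta a b c z

lemma slash_one_apply (f : ℍ → ℂ) (γ : SL(2, ℤ)) (z : ℍ) :
    (f ∣[(1 : ℤ)] γ) z = f (γ • z) / ((γ 1 0 : ℂ) * z + (γ 1 1 : ℂ)) := by
  rw [ModularForm.SL_slash_apply, zpow_neg_one, div_eq_mul_inv, ModularGroup.denom_apply]

lemma coe_SL_smul (γ : SL(2, ℤ)) (z : ℍ) :
    ((γ • z : ℍ) : ℂ) = ((γ 0 0 : ℂ) * z + (γ 0 1 : ℂ)) / ((γ 1 0 : ℂ) * z + (γ 1 1 : ℂ)) := by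
  rw [coe_specialLinearGroup_apply]
  simp

/-- For `C ≠ 0`, translating `τ` by an integer replaces `E` by any element of its class modulo `C`.
Dirichlet's theorem puts a large prime `p` there, where the Gauss sum is known; `χ` does not see the
change because `|D| ∣ C`. -/
lemma binaryThetaUHP_slash {a b c : ℤ} (ha : 0 < a) (hD : b ^ 2 - 4 * a * c < 0)
    (χ : DirichletCharacter ℂ (b ^ 2 - 4 * a * c).natAbs)
    (hχ : ∀ n : ℤ, χ (n : ZMod (b ^ 2 - 4 * a * c).natAbs) =
      (kroneckerSymbol (b ^ 2 - 4 * a * c) n : ℂ))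
    {γ : SL(2, ℤ)} (hγ : γ ∈ CongruenceSubgroup.Gamma0 (b ^ 2 - 4 * a * c).natAbs) :
    binaryThetaUHP a b c ∣[(1 : ℤ)] γ =
      χ ((γ 1 1 : ℤ) : ZMod (b ^ 2 - 4 * a * c).natAbs) • binaryThetaUHP a b c := by
  have hN : 0 < 4 * a * c - b ^ 2 := by linarith
  have hdvd : (4 * a * c - b ^ 2) ∣ γ 1 0 := by
    rw [CongruenceSubgroup.Gamma0_mem, ZMod.intCast_zmod_eq_zero_iff_dvd, Int.natCast_natAbs,
      abs_dvd] at hγ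
    rwa [← neg_sub, neg_dvd]
  have hdet : γ 0 0 * γ 1 1 - γ 0 1 * γ 1 0 = 1 := by
    have := γ.2
    rwa [Matrix.det_fin_two] at this
  have hγC := CongruenceSubgroup.Gamma0_mem.1 hγ
  ext z
  have him : 0 < (((γ 0 0 : ℂ) * z + (γ 0 1 : ℂ)) / ((γ 1 0 : ℂ) * z + (γ 1 1 : ℂ))).im := by
    rw [← coe_SL_smul]
    exact (γ • z).im_pos
  rw [slash_one_apply, Pi.smul_apply, smul_eq_mul, binaryThetaUHP, binaryThetaUHP, coe_SL_smul]
  generalize γ 0 0 = A at *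
  generalize γ 0 1 = B at *
  generalize γ 1 0 = C at *
  generalize γ 1 1 = E at *
  have hz := z.im_pos
  rw [← UpperHalfPlane.coe_im] at hz
  generalize (z : ℂ) = τ at *
  rcases eq_or_ne C 0 with rfl | hC
  · rcases Int.mul_eq_one_iff_eq_one_or_neg_one.1 (by linarith : A * E = 1) with ⟨rfl, rfl⟩ |
      ⟨rfl, rfl⟩
    · have : ((1 : ℤ) * τ + B) / (((0 : ℤ) : ℂ) * τ + (1 : ℤ)) = τ + B := by simp
      rw [this, binaryTheta_add_int]
      simp
    · have : (((-1 : ℤ) : ℂ) * τ + B) / (((0 : ℤ) : ℂ) * τ + (-1 : ℤ)) = τ + (-B : ℤ) := by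
        push_cast; ring
      -- For `-1` times a translation, the odd character compensates the weight one factor `-1`.
      have h1 : kroneckerSymbol (b ^ 2 - 4 * a * c) (-1) = -1 := by
        have := kroneckerSymbol_neg hD (n := 1) one_ne_zero
        rw [kroneckerSymbol_odd _ odd_one, jacobiSym.one_right] at this
        exact_mod_cast this
      rw [this, binaryTheta_add_int, hχ, h1]
      simp [div_neg]
  · have hcop : IsCoprime E (C.natAbs : ℤ) := by
      rw [Int.natCast_natAbs]
      refine (IsCoprime.abs_right_iff _ _).2 ⟨A, -B, by linarith⟩
    -- The lower bound makes `p` odd and prime to both `a` and the discriminant.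
    obtain ⟨p, hpgt, hp, hpE⟩ := Nat.forall_exists_prime_gt_and_zmodEq
      (2 + a.natAbs + (b ^ 2 - 4 * a * c).natAbs) (Int.natAbs_ne_zero.2 hC) hcop
    have : Fact p.Prime := ⟨hp⟩
    rw [Int.natCast_natAbs, Int.modEq_abs, Int.modEq_comm, Int.modEq_iff_dvd] at hpE
    obtain ⟨n, hn⟩ := hpE
    have hp' : (p : ℤ) = E + n * C := by linarith
    have hdet' : A * (p : ℤ) - (A * n + B) * C = 1 := by rw [hp']; linarith
    have hp2 : p ≠ 2 := by omega
    have hE : (p : ZMod (b ^ 2 - 4 * a * c).natAbs) = E := by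
      have h : ((p : ℤ) : ZMod (b ^ 2 - 4 * a * c).natAbs) = ((E + n * C : ℤ) : ZMod _) := by
        rw [hp']
      push_cast at h
      rw [h, hγC, mul_zero, add_zero]
    have hr : ((A * n + B : ℤ) : ZMod p) ≠ 0 := by
      intro h
      have h1 := congrArg (Int.cast (R := ZMod p)) hdet'
      rw [Int.cast_sub, Int.cast_mul, Int.cast_mul, h] at h1
      simp at h1
    have ha' : ((a : ℤ) : ZMod p) ≠ 0 := by
      rw [Ne, ZMod.intCast_zmod_eq_zero_iff_dvd]
      intro h
      have := Int.le_of_dvd ha h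
      omega
    have hD' : ((b ^ 2 - 4 * a * c : ℤ) : ZMod p) ≠ 0 := by
      rw [Ne, ZMod.intCast_zmod_eq_zero_iff_dvd, ← dvd_neg]
      intro h
      have := Int.le_of_dvd (by linarith) h
      omega
    have hden : (C : ℂ) * (τ + (-n : ℤ)) + p = C * τ + E := by
      have : (p : ℂ) = E + n * C := by exact_mod_cast congrArg (Int.cast (R := ℂ)) hp'
      rw [this]
      push_cast
      ring
    have hnum : (A : ℂ) * (τ + (-n : ℤ)) + (A * n + B : ℤ) = A * τ + B := by
      push_cast
      ring
    have hden0 : (C : ℂ) * τ + E ≠ 0 := denom_ne_zero_of_im_pos hz (Or.inl hC)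
    have hp0 : (p : ℂ) ≠ 0 := by exact_mod_cast hp.ne_zero
    -- The matrix is `γ` times translation by `n`, evaluated at `τ - n`.
    have htr := binaryTheta_transform ha hN hdet' hdvd (τ := τ + (-n : ℤ))
      (by simpa using hz) (by rw [hden, hnum]; exact him)
    rw [hden, hnum, binaryTheta_add_int, binaryGaussSum_eq hp2 hr ha' hD',
      ← kroneckerSymbol_prime hp2] at htr
    have hχp := hχ p
    rw [Int.cast_natCast, hE] at hχp
    rw [htr, hχp]
    field_simp

/-- The theta series of a positive definite integral binary quadratic form of discriminant `D`
is a modular form of weight one, level `|D|` and nebentypus the Kronecker symbol of `D`. -/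
theorem exists_modularForm_eq_binaryTheta {a b c D : ℤ} (ha : 0 < a)
    (habc : b ^ 2 - 4 * a * c = D) (hD : D < 0) (χ : DirichletCharacter ℂ D.natAbs)
    (hχ : ∀ n : ℤ, χ (n : ZMod D.natAbs) = (kroneckerSymbol D n : ℂ)) :
    ∃ f ∈ modularFormsWithCharacter D.natAbs χ 1, ∀ z : ℍ, f z = binaryTheta a b c z := by
  subst habc
  have hN : 0 < 4 * a * c - b ^ 2 := by linarith
  refine ⟨⟨⟨binaryThetaUHP a b c, ?_⟩, ?_, ?_⟩, ?_, fun z => rfl⟩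
  · rintro _ ⟨γ, hγ, rfl⟩
    have h := binaryThetaUHP_slash ha hD χ hχ (CongruenceSubgroup.Gamma1_in_Gamma0 _ hγ)
    rw [((CongruenceSubgroup.Gamma1_mem _ _).1 hγ).2.1, map_one, one_smul] at h
    exact h
  · rw [UpperHalfPlane.mdifferentiable_iff]
    refine (differentiableOn_binaryTheta ha hN).congr fun τ hτ => ?_
    change binaryTheta a b c (ofComplex τ) = _
    rw [ofComplex_apply_of_im_pos hτ]
  · intro cu hcu
    have hcu' : IsCusp cu (Matrix.SpecialLinearGroup.mapGL ℝ : SL(2, ℤ) →* _).range :=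
      hcu.mono (Subgroup.map_le_range _ _)
    rw [OnePoint.isBoundedAt_iff_forall_SL2Z hcu']
    intro γ _
    rw [isBoundedAtImInfty_iff]
    have hdet : γ 0 0 * γ 1 1 - γ 0 1 * γ 1 0 = 1 := by
      have := γ.2
      rwa [Matrix.det_fin_two] at this
    obtain ⟨M, hM⟩ := norm_binaryTheta_transform_le ha hN hdet
    refine ⟨M, 1, fun z hz => ?_⟩
    have h := hM z (by rwa [UpperHalfPlane.coe_im])
    rw [← coe_SL_smul] at h
    exact (slash_one_apply (binaryThetaUHP a b c) γ z) ▸ h (γ • z).im_pos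
  · intro γ hγ
    exact binaryThetaUHP_slash ha hD χ hχ hγ

end BinaryThetaModularForm

/-! ### Traces in number fields -/

section TraceForms

variable (K : Type*) [Field K] [NumberField K]

lemma mem_traceZeroIntegers_iff {x : 𝓞 K} :
    x ∈ traceZeroIntegers K ↔ Algebra.trace ℤ (𝓞 K) x = 0 := by
  change Algebra.trace ℚ K (x : K) = 0 ↔ _
  rw [← Algebra.coe_trace_int, Int.cast_eq_zero]

/-- The trace zero element `w = tr(b₁) b₀ - tr(b₀) b₁` satisfies `w² = d`. If `9 ∣ d`, then `w / 3`
is integral, so 3 divides both `tr(b₀)` and `tr(b₁)`, hence also `tr(1) = 2`. -/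
lemma nine_not_dvd_discr_of_finrank_eq_two (h2 : Module.finrank ℚ K = 2) :
    ¬ (9 : ℤ) ∣ NumberField.discr K := by
  rintro ⟨k, hk⟩
  let b : Module.Basis (Fin 2) ℤ (𝓞 K) :=
    Module.finBasisOfFinrankEq ℤ (𝓞 K) ((NumberField.RingOfIntegers.rank K).trans h2)
  have hd := NumberField.discr_eq_discr K b
  rw [Algebra.discr_def, Matrix.det_fin_two] at hd
  simp only [Algebra.traceMatrix_apply, Algebra.traceForm_apply] at hd
  set tr := Algebra.trace ℤ (𝓞 K) with htr
  obtain ⟨α, β, h1⟩ : ∃ α β : ℤ, (1 : 𝓞 K) = α • b 0 + β • b 1 :=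
    ⟨b.repr 1 0, b.repr 1 1, by
      conv_lhs => rw [← b.sum_repr 1]
      rw [Fin.sum_univ_two]⟩
  have htr1 : tr 1 = 2 := by
    have := Algebra.trace_algebraMap_of_basis b (1 : ℤ)
    simpa using this
  have e0 : α * tr (b 0 * b 0) + β * tr (b 0 * b 1) = tr (b 0) := by
    conv_rhs => rw [← mul_one (b 0), h1]
    simp only [mul_add, mul_smul_comm, map_add, map_smul, smul_eq_mul]
  have e1 : α * tr (b 0 * b 1) + β * tr (b 1 * b 1) = tr (b 1) := by
    conv_rhs => rw [← mul_one (b 1), h1]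
    simp only [mul_add, mul_smul_comm, map_add, map_smul, smul_eq_mul, mul_comm (b 1) (b 0)]
  have e2 : α * tr (b 0) + β * tr (b 1) = 2 := by
    rw [← htr1]
    conv_rhs => rw [h1]
    simp only [map_add, map_smul, smul_eq_mul]
  rw [mul_comm (b 1) (b 0)] at hd
  set w : 𝓞 K := tr (b 1) • b 0 - tr (b 0) • b 1 with hw
  have hw0 : tr w = 0 := by
    simp only [hw, map_sub, map_smul, smul_eq_mul]
    ring
  have hw2 : tr (w * w) = 2 * NumberField.discr K := by
    have : w * w = (tr (b 1) * tr (b 1)) • (b 0 * b 0) -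
        (2 * tr (b 0) * tr (b 1)) • (b 0 * b 1) + (tr (b 0) * tr (b 0)) • (b 1 * b 1) := by
      rw [hw]
      simp only [zsmul_eq_mul]
      push_cast
      ring
    rw [this, map_add, map_sub, map_smul, map_smul, map_smul, ← hd]
    simp only [smul_eq_mul]
    linear_combination (tr (b 1) * tr (b 0 * b 1) - tr (b 0) * tr (b 1 * b 1)) * e0 +
      (tr (b 0) * tr (b 0 * b 1) - tr (b 1) * tr (b 0 * b 0)) * e1 +
      (tr (b 0 * b 0) * tr (b 1 * b 1) - tr (b 0 * b 1) * tr (b 0 * b 1)) * e2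
  have hsq : w * w = ((NumberField.discr K : ℤ) : 𝓞 K) := by
    set M := Algebra.leftMulMatrix b w with hM
    have hMtr : M 0 0 + M 1 1 = 0 := by
      rw [← Matrix.trace_fin_two, hM, ← Algebra.trace_eq_matrix_trace b w]
      exact hw0
    have hMM : Algebra.leftMulMatrix b (w * w) = M * M := map_mul _ _ _
    -- Cayley–Hamilton for a trace zero 2×2 matrix: its square is scalar.
    have hscalar : M * M = (M 0 0 * M 0 0 + M 0 1 * M 1 0) • (1 : Matrix (Fin 2) (Fin 2) ℤ) := by
      have h11 : M 1 1 = -M 0 0 := by linarith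
      ext i j
      fin_cases i <;> fin_cases j <;> simp [Matrix.mul_apply, Fin.sum_univ_two, h11] <;> ring
    have hval : w * w = ((M 0 0 * M 0 0 + M 0 1 * M 1 0 : ℤ) : 𝓞 K) := by
      apply Algebra.leftMulMatrix_injective b
      rw [hMM, hscalar, ← zsmul_one, map_zsmul, map_one]
    have htrval := hw2
    rw [hval, ← zsmul_one, map_zsmul, htr1, smul_eq_mul] at htrval
    rw [hval, show M 0 0 * M 0 0 + M 0 1 * M 1 0 = NumberField.discr K by linarith]
  have hint : IsIntegral ℤ ((w : K) / 3) := by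
    refine IsIntegral.of_pow (n := 2) two_pos ?_
    have : ((w : K) / 3) ^ 2 = algebraMap ℤ K k := by
      have h : ((w * w : 𝓞 K) : K) = ((NumberField.discr K : ℤ) : K) := by rw [hsq]; simp
      rw [hk] at h
      push_cast at h
      simp only [eq_intCast]
      field_simp
      linear_combination h
    rw [this]
    exact isIntegral_algebraMap
  obtain ⟨w', hw'⟩ : ∃ w' : 𝓞 K, w = (3 : ℤ) • w' := by
    obtain ⟨w', hw'⟩ : ∃ w' : 𝓞 K, (w' : K) = w / 3 := ⟨⟨_, hint⟩, rfl⟩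
    refine ⟨w', NumberField.RingOfIntegers.coe_injective ?_⟩
    simp only [zsmul_eq_mul, Int.cast_ofNat, map_mul, hw', map_ofNat]
    field_simp
  have hrepr := congrArg b.repr hw'
  have hd0 : (3 : ℤ) ∣ tr (b 1) := by
    refine ⟨b.repr w' 0, ?_⟩
    have := congrArg (fun f => f 0) hrepr
    simpa [hw, -zsmul_eq_mul] using this
  have hd1 : (3 : ℤ) ∣ tr (b 0) := by
    refine ⟨-b.repr w' 1, ?_⟩
    have := congrArg (fun f => f 1) hrepr
    simp [hw, -zsmul_eq_mul] at this
    linarith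
  have : (3 : ℤ) ∣ 2 := by
    rw [← e2]
    exact dvd_add (hd1.mul_left _) (hd0.mul_left _)
  norm_num at this

/-- If 3 divided every trace, the 3×3 Gram matrix would be divisible by 3 and its determinant by 27.
Otherwise some trace is prime to `tr(1) = 3`, and Bézout applies. -/
lemma exists_trace_eq_one (h3 : Module.finrank ℚ K = 3)
    (hd : ¬ (27 : ℤ) ∣ NumberField.discr K) : ∃ e : 𝓞 K, Algebra.trace ℤ (𝓞 K) e = 1 := by
  let b : Module.Basis (Fin 3) ℤ (𝓞 K) :=
    Module.finBasisOfFinrankEq ℤ (𝓞 K) ((NumberField.RingOfIntegers.rank K).trans h3)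
  have htr1 : Algebra.trace ℤ (𝓞 K) 1 = 3 := by
    have := Algebra.trace_algebraMap_of_basis b (1 : ℤ)
    simpa using this
  by_cases h : ∀ x : 𝓞 K, (3 : ℤ) ∣ Algebra.trace ℤ (𝓞 K) x
  · exfalso
    apply hd
    choose m hm using h
    have hmat : Algebra.traceMatrix ℤ b = (3 : ℤ) • Matrix.of fun i j => m (b i * b j) := by
      ext i j
      simp [Algebra.traceMatrix_apply, Algebra.traceForm_apply, hm]
    rw [← NumberField.discr_eq_discr K b, Algebra.discr_def, hmat, Matrix.det_smul]
    exact dvd_mul_of_dvd_left (by norm_num) _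
  · push Not at h
    obtain ⟨x, hx⟩ := h
    have hcop : IsCoprime (Algebra.trace ℤ (𝓞 K) x) 3 :=
      ((Int.prime_three.coprime_iff_not_dvd).2 hx).symm
    obtain ⟨u, v, huv⟩ := hcop
    refine ⟨u • x + v • 1, ?_⟩
    rw [map_add, map_smul, map_smul, htr1]
    exact huv

/-- Frobenius for matrices over `ZMod 2`: `tr(M²) = tr(M)²`. -/
lemma two_dvd_trace_sq {x : 𝓞 K} (hx : Algebra.trace ℤ (𝓞 K) x = 0) :
    (2 : ℤ) ∣ Algebra.trace ℤ (𝓞 K) (x * x) := by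
  let b := NumberField.RingOfIntegers.basis K
  rw [show (2 : ℤ) = ((2 : ℕ) : ℤ) from rfl, ← ZMod.intCast_zmod_eq_zero_iff_dvd, ← sq, Algebra.trace_eq_matrix_trace b, map_pow]
  rw [Algebra.trace_eq_matrix_trace b] at hx
  have h := ZMod.trace_pow_card (p := 2) ((Algebra.leftMulMatrix b x).map (Int.castRingHom (ZMod 2)))
  have h1 : ∀ M : Matrix (Module.Free.ChooseBasisIndex ℤ (𝓞 K)) (Module.Free.ChooseBasisIndex ℤ (𝓞 K)) ℤ,
      (M.map (Int.castRingHom (ZMod 2))).trace = (M.trace : ZMod 2) := by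
    intro M
    simp [Matrix.trace]
  rw [← Matrix.map_pow, h1, h1, hx] at h
  simpa using h

/-- The trace is the sum of the squares of the real conjugates of `x`. -/
lemma trace_sq_pos [NumberField.IsTotallyReal K] {x : K} (hx : x ≠ 0) :
    0 < Algebra.trace ℚ K (x * x) := by
  have h := trace_eq_sum_embeddings (K := ℚ) (L := K) ℂ (x := x * x)
  have hσ : ∀ σ : K →ₐ[ℚ] ℂ, ∃ r : ℝ, r ≠ 0 ∧ σ x = r := by
    intro σ
    have hr := NumberField.IsTotallyReal.complexEmbedding_isReal (σ : K →+* ℂ)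
    refine ⟨hr.embedding x, ?_, ?_⟩
    · simpa using hx
    · exact (hr.coe_embedding_apply x).symm
  choose r hr0 hr using hσ
  have h2 : ((Algebra.trace ℚ K (x * x) : ℝ) : ℂ) = ((∑ σ : K →ₐ[ℚ] ℂ, r σ * r σ : ℝ) : ℂ) := by
    rw [Complex.ofReal_ratCast]
    refine Eq.trans (by simp) (h.trans ?_)
    push_cast
    refine Finset.sum_congr rfl fun σ _ => ?_
    rw [map_mul, hr]
  have h3 := Complex.ofReal_injective h2
  have : Nonempty (K →ₐ[ℚ] ℂ) := by
    rw [← Fintype.card_pos_iff, AlgHom.card]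
    exact Module.finrank_pos
  have h4 : 0 < ∑ σ : K →ₐ[ℚ] ℂ, r σ * r σ :=
    Finset.sum_pos (fun σ _ => mul_self_pos.2 (hr0 σ)) Finset.univ_nonempty
  rw [← h3] at h4
  exact_mod_cast h4

lemma trace_int_sq_pos [NumberField.IsTotallyReal K] {x : 𝓞 K} (hx : x ≠ 0) :
    0 < Algebra.trace ℤ (𝓞 K) (x * x) := by
  have h := trace_sq_pos K (x := (x : K)) (by rwa [Ne, NumberField.RingOfIntegers.coe_eq_zero_iff])
  rw [← map_mul, ← Algebra.coe_trace_int] at h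
  exact_mod_cast h

end TraceForms

/-! ### The trace form of a totally real cubic field -/

section CubicTraceForm

/-- Determinant and divisibility relations between the entries of a symmetric matrix
`(s, g, h; g, p, q; h, q, r)` for which `(3, α, β)` is mapped to `(1, 0, 0)`. -/
lemma symmetric_minor_relations {α β d g h p q r s : ℤ}
    (h0 : 3 * g + (α * p + β * q) = 0) (h1 : 3 * h + (α * q + β * r) = 0)
    (h2 : 3 * s + (α * g + β * h) = 1)
    (hd : s * (p * r - q * q) - g * (g * r - q * h) + h * (g * q - p * h) = d) :
    p * r - q * q = 3 * d ∧ p = 3 * (s * p - g * g) - β * β * d ∧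
      q = 3 * (s * q - g * h) + α * β * d ∧ r = 3 * (s * r - h * h) - α * α * d := by
  -- Cramer's rule: applying the adjugate to `S (3, α, β) = (1, 0, 0)` shows that its first column
  -- is `d (3, α, β)`. The three entries are `hdet`, `e1` and `e2`, up to sign.
  have hdet : p * r - q * q = 3 * d := by
    linear_combination 3 * hd - (p * r - q * q) * h2 + (g * r - q * h) * h0 -
      (g * q - p * h) * h1
  have e1 : r * g - q * h = -(α * d) := by
    have : (3 : ℤ) * (r * g - q * h) = 3 * (-(α * d)) := by
      linear_combination r * h0 - q * h1 - α * hdet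
    exact mul_left_cancel₀ (by norm_num) this
  have e2 : p * h - q * g = -(β * d) := by
    have : (3 : ℤ) * (p * h - q * g) = 3 * (-(β * d)) := by
      linear_combination p * h1 - q * h0 - β * hdet
    exact mul_left_cancel₀ (by norm_num) this
  -- The last three relations show that `p`, `q`, `r` are divisible by 3 whenever `d` is, which
  -- allows division by `gcd(3, d)`.
  refine ⟨hdet, ?_, ?_, ?_⟩
  · linear_combination -p * h2 + g * h0 + β * e2
  · linear_combination -q * h2 + h * h0 - α * e2
  · linear_combination -r * h2 + h * h1 + α * e1

variable (K : Type*) [Field K] [NumberField K]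

/-- A basis of the trace zero integers of a cubic field, with the relations satisfied by the
entries of the Gram matrix of its trace form. -/
lemma exists_basis_traceZeroIntegers (h3 : Module.finrank ℚ K = 3) {e : 𝓞 K}
    (he : Algebra.trace ℤ (𝓞 K) e = 1) :
    ∃ v : Module.Basis (Fin 2) ℤ (traceZeroIntegers K), ∃ α β g h s : ℤ,
      ∃ p, p = Algebra.trace ℤ (𝓞 K) (v 0 * v 0) ∧
      ∃ q, q = Algebra.trace ℤ (𝓞 K) (v 0 * v 1) ∧
      ∃ r, r = Algebra.trace ℤ (𝓞 K) (v 1 * v 1) ∧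
        3 * g + (α * p + β * q) = 0 ∧ 3 * h + (α * q + β * r) = 0 ∧
        3 * s + (α * g + β * h) = 1 ∧
        s * (p * r - q * q) - g * (g * r - q * h) + h * (g * q - p * h) =
          NumberField.discr K := by
  have hli : ∀ c : ℤ, ∀ x ∈ traceZeroIntegers K, c • e + x = 0 → c = 0 := by
    intro c x hx hc
    have := congrArg (Algebra.trace ℤ (𝓞 K)) hc
    rw [map_add, map_smul, he, (mem_traceZeroIntegers_iff K).1 hx, map_zero] at this
    simpa using this
  have hsp : ∀ z : 𝓞 K, ∃ c : ℤ, z + c • e ∈ traceZeroIntegers K := by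
    intro z
    refine ⟨-Algebra.trace ℤ (𝓞 K) z, ?_⟩
    rw [mem_traceZeroIntegers_iff, map_add, map_smul, he]
    simp
  have hrank : Module.finrank ℤ (traceZeroIntegers K) = 2 := by
    have b := Module.Basis.mkFinCons e (Module.finBasis ℤ (traceZeroIntegers K)) hli hsp
    have h := Module.finrank_eq_card_basis b
    rw [NumberField.RingOfIntegers.rank, h3, Fintype.card_fin] at h
    omega
  let v := Module.finBasisOfFinrankEq ℤ (traceZeroIntegers K) hrank
  -- Since `e` has trace 1, it splits the trace map, and a basis of the kernel extends to one of `𝓞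
  -- K`.
  let B := Module.Basis.mkFinCons e v hli hsp
  have hB0 : B 0 = e := by simp [B]
  have hB1 : B 1 = v 0 := by
    have := congrFun (Module.Basis.coe_mkFinCons e v hli hsp) 1
    exact this
  have hB2 : B 2 = v 1 := by
    have := congrFun (Module.Basis.coe_mkFinCons e v hli hsp) 2
    exact this
  have hd := NumberField.discr_eq_discr K B
  rw [Algebra.discr_def, Matrix.det_fin_three] at hd
  simp only [Algebra.traceMatrix_apply, Algebra.traceForm_apply, hB0, hB1, hB2] at hd
  have htr1 : Algebra.trace ℤ (𝓞 K) 1 = 3 := by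
    have := Algebra.trace_algebraMap_of_basis B (1 : ℤ)
    simpa using this
  -- `1 - 3e` has trace zero. The Gram matrix sends the coordinates `(3, α, β)` of 1 to the traces
  -- `(1, 0, 0)` of the basis.
  obtain ⟨α, β, hw⟩ : ∃ α β : ℤ, (1 : 𝓞 K) = (3 : ℤ) • e + (α • (v 0 : 𝓞 K) + β • (v 1 : 𝓞 K)) := by
    have hmem : (1 : 𝓞 K) - (3 : ℤ) • e ∈ traceZeroIntegers K := by
      rw [mem_traceZeroIntegers_iff, map_sub, map_smul, he, htr1]
      simp
    refine ⟨v.repr ⟨_, hmem⟩ 0, v.repr ⟨_, hmem⟩ 1, ?_⟩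
    have h := congrArg (Submodule.subtype _) (v.sum_repr ⟨_, hmem⟩)
    rw [Fin.sum_univ_two, map_add, map_smul, map_smul] at h
    simp only [Submodule.subtype_apply] at h
    rw [h]
    abel
  have hv0 := (mem_traceZeroIntegers_iff K).1 (v 0).2
  have hv1 := (mem_traceZeroIntegers_iff K).1 (v 1).2
  rw [mul_comm (v 0 : 𝓞 K) e, mul_comm (v 1 : 𝓞 K) e, mul_comm (v 1 : 𝓞 K) (v 0)] at hd
  refine ⟨v, α, β, Algebra.trace ℤ (𝓞 K) (e * v 0), Algebra.trace ℤ (𝓞 K) (e * v 1),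
    Algebra.trace ℤ (𝓞 K) (e * e), _, rfl, _, rfl, _, rfl, ?_, ?_, ?_, ?_⟩
  · rw [← hv0]
    conv_rhs => rw [← one_mul (v 0 : 𝓞 K), hw]
    simp only [add_mul, smul_mul_assoc, map_add, map_smul, smul_eq_mul,
      mul_comm (v 1 : 𝓞 K) (v 0)]
  · rw [← hv1]
    conv_rhs => rw [← one_mul (v 1 : 𝓞 K), hw]
    simp only [add_mul, smul_mul_assoc, map_add, map_smul, smul_eq_mul]
  · rw [← he]
    conv_rhs => rw [← mul_one e, hw]
    simp only [mul_add, mul_smul_comm, map_add, map_smul, smul_eq_mul]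
  · rw [← hd]
    ring

/-- The scaled trace form of a totally real cubic field whose discriminant is not divisible
by `27` is a positive definite integral binary quadratic form of discriminant `d₃`. -/
lemma exists_scaledTraceForm_eq_binaryForm [NumberField.IsTotallyReal K]
    (h3 : Module.finrank ℚ K = 3) (hd : ¬ (27 : ℤ) ∣ NumberField.discr K) :
    ∃ φ : traceZeroIntegers K ≃ ℤ × ℤ, ∃ a b c : ℤ,
      (∀ x, scaledTraceForm K x = (binaryForm a b c (φ x).1 (φ x).2 : ℤ)) ∧ 0 < a ∧
        b ^ 2 - 4 * a * c = threeReflection (NumberField.discr K) ∧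
        threeReflection (NumberField.discr K) < 0 := by
  obtain ⟨e, he⟩ := exists_trace_eq_one K h3 hd
  obtain ⟨v, α, β, g, h, s, p, hp, q, hq, r, hr, e0, e1, e2, e3⟩ :=
    exists_basis_traceZeroIntegers K h3 he
  obtain ⟨hdet, hp3, hq3, hr3⟩ := symmetric_minor_relations e0 e1 e2 e3
  have hp2 : (2 : ℤ) ∣ p := hp ▸ two_dvd_trace_sq K ((mem_traceZeroIntegers_iff K).1 (v 0).2)
  have hr2 : (2 : ℤ) ∣ r := hr ▸ two_dvd_trace_sq K ((mem_traceZeroIntegers_iff K).1 (v 1).2)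
  have htrace : ∀ x y : ℤ, Algebra.trace ℤ (𝓞 K) ((x • (v 0 : 𝓞 K) + y • (v 1 : 𝓞 K)) *
      (x • (v 0 : 𝓞 K) + y • (v 1 : 𝓞 K))) = p * x ^ 2 + 2 * q * x * y + r * y ^ 2 := by
    intro x y
    rw [hp, hq, hr]
    simp only [mul_add, add_mul, smul_mul_assoc, mul_smul_comm, map_add, map_smul, smul_eq_mul,
      mul_comm (v 1 : 𝓞 K) (v 0)]
    ring
  have hpos : ∀ x y : ℤ, (x ≠ 0 ∨ y ≠ 0) → 0 < p * x ^ 2 + 2 * q * x * y + r * y ^ 2 := by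
    intro x y hxy
    rw [← htrace]
    have hne : x • (v 0 : 𝓞 K) + y • (v 1 : 𝓞 K) ≠ 0 := by
      intro h0
      have h0' : x • v 0 + y • v 1 = 0 := Subtype.ext (by simpa using h0)
      have hx := congrArg (fun t => v.repr t 0) h0'
      have hy := congrArg (fun t => v.repr t 1) h0'
      simp only [map_add, map_smul, Finsupp.add_apply, Finsupp.smul_apply, Module.Basis.repr_self,
        map_zero, Finsupp.zero_apply, smul_eq_mul, Finsupp.single_eq_same, mul_one,
        Finsupp.single_eq_of_ne (by decide : (0 : Fin 2) ≠ 1),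
        Finsupp.single_eq_of_ne (by decide : (1 : Fin 2) ≠ 0), mul_zero, add_zero, zero_add]
        at hx hy
      exact hxy.elim (fun h => h hx) (fun h => h hy)
    exact trace_int_sq_pos K hne
  have hp0 : 0 < p := by simpa using hpos 1 0 (Or.inl one_ne_zero)
  have hdet0 : 0 < p * r - q * q := by
    -- At `(-q, p)` the form takes the value `p (p r - q²)`.
    have := hpos (-q) p (Or.inr hp0.ne')
    have h' : 0 < p * (p * r - q * q) := by linarith
    exact (mul_pos_iff_of_pos_left hp0).1 h'
  set G : ℤ := (Int.gcd 3 (NumberField.discr K) : ℤ) with hG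
  have hGcases : G = 1 ∨ G = 3 := by
    have : Int.gcd 3 (NumberField.discr K) ∣ 3 := by
      have := Int.gcd_dvd_natAbs_left 3 (NumberField.discr K)
      simpa using this
    rcases (Nat.dvd_prime Nat.prime_three).1 this with h | h
    · left; rw [hG, h]; rfl
    · right; rw [hG, h]; rfl
  have hGd : G ∣ NumberField.discr K := Int.gcd_dvd_right _ _
  have hG0 : 0 < G := by rcases hGcases with h | h <;> rw [h] <;> norm_num
  -- Evenness of `tr(x²)` supplies the 2; the relations modulo 3 supply the factor `G` when `G = 3`.
  obtain ⟨a, ha⟩ : 2 * G ∣ p := by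
    rcases hGcases with hg | hg
    · simpa [hg] using hp2
    · rw [hg] at hGd ⊢
      have : (3 : ℤ) ∣ p := by
        rw [hp3]
        exact dvd_sub (dvd_mul_right _ _) (hGd.mul_left _)
      omega
  obtain ⟨b, hb⟩ : G ∣ q := by
    rcases hGcases with hg | hg
    · simp [hg]
    · rw [hg] at hGd ⊢
      rw [hq3]
      exact dvd_add (dvd_mul_right _ _) (hGd.mul_left _)
  obtain ⟨c, hc⟩ : 2 * G ∣ r := by
    rcases hGcases with hg | hg
    · simpa [hg] using hr2
    · rw [hg] at hGd ⊢
      have : (3 : ℤ) ∣ r := by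
        rw [hr3]
        exact dvd_sub (dvd_mul_right _ _) (hGd.mul_left _)
      omega
  have hD : threeReflection (NumberField.discr K) = b ^ 2 - 4 * a * c := by
    rw [threeReflection, ← hG]
    refine Int.ediv_eq_of_eq_mul_left (by positivity) ?_
    rw [← hdet, ha, hb, hc]
    ring
  refine ⟨v.equivFun.toEquiv.trans (finTwoArrowEquiv ℤ), a, b, c, fun x => ?_, ?_, hD.symm, ?_⟩
  · have hx : (x : 𝓞 K) = v.repr x 0 • (v 0 : 𝓞 K) + v.repr x 1 • (v 1 : 𝓞 K) := by
      have h := congrArg (Submodule.subtype _) (v.sum_repr x)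
      rw [Fin.sum_univ_two, map_add, map_smul, map_smul] at h
      exact h.symm
    have ht := htrace (v.repr x 0) (v.repr x 1)
    rw [← hx] at ht
    have ht' : Algebra.trace ℚ K (((x : 𝓞 K) : K) ^ 2) =
        ((p * v.repr x 0 ^ 2 + 2 * q * v.repr x 0 * v.repr x 1 + r * v.repr x 1 ^ 2 : ℤ) : ℚ) := by
      rw [← ht, Algebra.coe_trace_int]
      simp [sq]
    have hGQ : (Int.gcd 3 (NumberField.discr K) : ℚ) = (G : ℚ) := by rw [hG]; simp
    have hGQ0 : (G : ℚ) ≠ 0 := by exact_mod_cast hG0.ne'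
    change _ = ((binaryForm a b c (v.repr x 0) (v.repr x 1) : ℤ) : ℚ)
    rw [scaledTraceForm, ht', hGQ, ha, hb, hc, div_eq_iff (by positivity)]
    simp only [binaryForm]
    push_cast
    ring
  · exact (mul_pos_iff_of_pos_left (by positivity : 0 < 2 * G)).1 (ha ▸ hp0)
  · rw [hD]
    have h' : 0 < G ^ 2 * (4 * a * c - b ^ 2) := by
      have : p * r - q * q = G ^ 2 * (4 * a * c - b ^ 2) := by
        rw [ha, hb, hc]
        ring
      rwa [this] at hdet0
    have := (mul_pos_iff_of_pos_left (by positivity : 0 < G ^ 2)).1 h'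
    linarith

end CubicTraceForm

/-! ### Combining the trace form with its theta series -/

theorem mainTheorem4 (K : Type*) [Field K] [NumberField K] [NumberField.IsTotallyReal K]
    (hdeg : Module.finrank ℚ K = 3)
    (hfund : IsFundamentalDiscriminant (NumberField.discr K)) :
    (∀ z : UpperHalfPlane, Summable (thetaTerm K z)) ∧
    ∃ χ : DirichletCharacter ℂ (threeReflection (NumberField.discr K)).natAbs,
      (∀ n : ℤ, χ (n : ZMod (threeReflection (NumberField.discr K)).natAbs) =
        (kroneckerSymbol (threeReflection (NumberField.discr K)) n : ℂ)) ∧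
      ∃ f ∈ modularFormsWithCharacter (threeReflection (NumberField.discr K)).natAbs χ 1,
        ∀ z : UpperHalfPlane, f z = thetaSeries K z := by
  have h27 : ¬ (27 : ℤ) ∣ NumberField.discr K := by
    obtain ⟨F, _, _, h2, hF⟩ := hfund
    rw [← hF]
    exact fun h => nine_not_dvd_discr_of_finrank_eq_two F h2 (dvd_trans ⟨3, by norm_num⟩ h)
  obtain ⟨φ, a, b, c, hφ, ha, habc, hD⟩ := exists_scaledTraceForm_eq_binaryForm K hdeg h27
  have hterm : ∀ z x, thetaTerm K z x = Complex.exp (2 * Real.pi * Complex.I * (z : ℂ) *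
      (binaryForm a b c (φ x).1 (φ x).2 : ℤ)) := by
    intro z x
    rw [thetaTerm, hφ, Rat.cast_intCast]
  refine ⟨fun z => ?_, ?_⟩
  · have h := φ.summable_iff.2 (binaryTheta_summable ha (by linarith : 0 < 4 * a * c - b ^ 2)
      z.im_pos)
    exact h.congr fun x => (hterm z x).symm
  -- As the discriminant of an integral form, `d₃` is congruent to `b²` modulo 4.
  · have h4 : threeReflection (NumberField.discr K) % 4 = 0 ∨
        threeReflection (NumberField.discr K) % 4 = 1 := by
      rw [← habc]
      rcases Int.even_or_odd' b with ⟨k, rfl | rfl⟩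
      · exact Or.inl (Int.emod_eq_zero_of_dvd ⟨k ^ 2 - a * c, by ring⟩)
      · refine Or.inr ?_
        rw [show (2 * k + 1) ^ 2 - 4 * a * c = 1 + 4 * (k ^ 2 + k - a * c) by ring,
          Int.add_mul_emod_self_left]
        rfl
    obtain ⟨χ, hχ⟩ := exists_dirichletCharacter_kroneckerSymbol hD h4
    obtain ⟨f, hf, hfz⟩ := exists_modularForm_eq_binaryTheta ha habc hD χ hχ
    refine ⟨χ, hχ, f, hf, fun z => ?_⟩
    rw [hfz, binaryTheta, thetaSeries, ← φ.tsum_eq]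
    exact tsum_congr fun x => (hterm z x).symm
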